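/- Let $N\ge 1$ be an integer and $\hat t>0$. For $k=1,\dots,N$ let $A_k\in\mathbb R^{d_k\times d_k}$, $B_k\in\mathbb R^{d_k\times m_k}$, let $Q_k,\hat Q_k\in\mathbb R^{d_k\times d_k}$ be symmetric non-negative definite, $R_k\in\mathbb R^{m_k\times m_k}$ symmetric positive definite, $\bar x^k\in\mathbb R^{d_k}$ and $\lambda_k>0$. Put $\lambda_k'=\sum_{\ell\ne k}\lambda_\ell$, $\widetilde\lambda=\sum_{k}\lambda_k$, $d=\sum_k d_k$, $m=\sum_k m_k$; let $A,B,Q,\hat Q,R$ be the block-diagonal matrices with blocks $A_k,B_k,Q_k,\hat Q_k,R_k$, and $\bar x=(\bar x^1,\dots,\bar x^N)\in\mathbb R^d$. Write $\|v\|_M=\sqrt{\langle v,Mv\rangle}$, let $\mathbf 1_{\{0\}}$ be the indicator function of $\{0\}$, and let $\mathbb U=\bigcup_{k=1}^N\{0\}\times\cdots\times\mathbb R^{m_k}\times\cdots\times\{0\}\subset\mathbb R^m$ ($\mathbb R^{m_k}$ being the $k$-th factor). Consider the problem of minimizing $$J(x,u)=\int_0^{\hat t}\Bigl(\tfrac12\bigl(\langle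 x(t),Qx(t)\rangle+\langle u(t),Ru(t)\rangle\bigr)-\sum_{k=1}^N\lambda_k\mathbf 1_{\{0\}}(u^k(t))\Bigr)\,dt+\tfrac12\langle x(\hat t),\hat Qx(\hat t)\rangle\in(-\infty,+\infty]$$ over all processes $(x,u)$, i.e. all pairs of a Lebesgue measurable $u=(u^1,\dots,u^N):[0,\hat t]\to\mathbb U$ and an absolutely continuous $x:[0,\hat t]\to\mathbb R^d$ with $x(0)=\bar x$ and $\dot x(t)=Ax(t)+Bu(t)$ for a.e. $t\in[0,\hat t]$. A process $(x_*,u_*)$ is a local minimizer if for some $\varepsilon>0$ one has $J(x_*,u_*)\le J(x,u)$ for every process $(x,u)$ with $\sup_{t\in[0,\hat t]}\|x(t)-x_*(t)\|\le\varepsilon$. If $(x_*,u_*)$ is a local minimizer, then there exist an absolutely continuous map $p=(p^1,\dots,p^N):[0,\hat t]\to\mathbb R^{d_1}\times\cdots\times\mathbb R^{d_N}$ and a measurable map $\sigma^{\mathrm{LQ}}:[0,\hat t]\to\{1,\dots,N\}$ such that $x_*(0)=\bar x$, $p(\hat t)=-\hat Qx_*(\hat t)$, and for a.e. $t\in[0,\hat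 t]$: 1. $\dot x_*(t)=Ax_*(t)+Bu_*(t)$ and $\dot p(t)=-A^\top p(t)+Qx_*(t)$; 2. for each $k\ne\sigma^{\mathrm{LQ}}(t)$, $u_*^k(t)=0$; and for $k=\sigma^{\mathrm{LQ}}(t)$, $$u_*^k(t)\in\begin{cases}\{R_k^{-1}B_k^\top p^k(t)\}&\text{if }\|p^k(t)\|^2_{B_kR_k^{-1}B_k^\top}>2\lambda_k,\\ \{0\}\cup\{R_k^{-1}B_k^\top p^k(t)\}&\text{if }\|p^k(t)\|^2_{B_kR_k^{-1}B_k^\top}=2\lambda_k,\\ \{0\}&\text{otherwise;}\end{cases}$$ 3. $$\sigma^{\mathrm{LQ}}(t)\in\operatorname*{arg\,max}_{k\in\{1,\dots,N\}}\begin{cases}\lambda_k'+\tfrac12\|p^k(t)\|^2_{B_kR_k^{-1}B_k^\top}&\text{if }\|p^k(t)\|^2_{B_kR_k^{-1}B_k^\top}\ge2\lambda_k,\\ \widetilde\lambda&\text{otherwise.}\end{cases}$$ Moreover, the map $$t\mapsto\langle p(t),Ax_*(t)+Bu_*(t)\rangle+\sum_{k=1}^N\lambda_k\mathbf 1_{\{0\}}(u_*^k(t))-\tfrac12\bigl(\langle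 x_*(t),Qx_*(t)\rangle+\langle u_*(t),Ru_*(t)\rangle\bigr)$$ is a.e. equal to a constant. -/

import Mathlib

open MeasureTheory Set
open scoped Matrix

noncomputable section

/-- The weighted norm `‖v‖_M = √⟨v, M v⟩` (for a symmetric non-negative definite `M`). -/
def weightedNorm {n : Type*} [Fintype n] (M : Matrix n n ℝ) (v : n → ℝ) : ℝ :=
  √(v ⬝ᵥ (M *ᵥ v))

/-- The data of the multiplexed `L⁰`-regularized linear quadratic problem for `N` systems
`ẋᵏ = A_k xᵏ + B_k uᵏ` on the time interval `[0, T]`. -/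
structure MuxLQ (N : ℕ) where
  /-- state dimensions -/
  d : Fin N → ℕ
  /-- control dimensions -/
  m : Fin N → ℕ
  /-- the final time -/
  T : ℝ
  A : ∀ k, Matrix (Fin (d k)) (Fin (d k)) ℝ
  B : ∀ k, Matrix (Fin (d k)) (Fin (m k)) ℝ
  Q : ∀ k, Matrix (Fin (d k)) (Fin (d k)) ℝ
  /-- the terminal weights -/
  Qhat : ∀ k, Matrix (Fin (d k)) (Fin (d k)) ℝ
  R : ∀ k, Matrix (Fin (m k)) (Fin (m k)) ℝ
  /-- the regularization parameters -/
  lam : Fin N → ℝ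
  /-- the initial states -/
  xbar : ∀ k, Fin (d k) → ℝ
  N_pos : 0 < N
  T_pos : 0 < T
  Q_posSemidef : ∀ k, (Q k).PosSemidef
  Qhat_posSemidef : ∀ k, (Qhat k).PosSemidef
  R_posDef : ∀ k, (R k).PosDef
  lam_pos : ∀ k, 0 < lam k

namespace MuxLQ

variable {N : ℕ} (P : MuxLQ N)

/-- The joint state space `ℝ^d = ℝ^{d_1} × ⋯ × ℝ^{d_N}` of stacked vectors. Its norm is the maximum
norm; only its topology and its uniform structure matter below. -/
abbrev State : Type := ((k : Fin N) × Fin (P.d k)) → ℝ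

/-- The joint control space `ℝ^m = ℝ^{m_1} × ⋯ × ℝ^{m_N}` of stacked vectors. -/
abbrev Control : Type := ((k : Fin N) × Fin (P.m k)) → ℝ

/-- The `k`-th block `wᵏ` of a stacked vector `w`. -/
def block {n : Fin N → ℕ} (w : ((k : Fin N) × Fin (n k)) → ℝ) (k : Fin N) : Fin (n k) → ℝ :=
  fun i => w ⟨k, i⟩

/-- `A = blkdiag(A_1, …, A_N)` -/
def jointA : Matrix ((k : Fin N) × Fin (P.d k)) ((k : Fin N) × Fin (P.d k)) ℝ :=
  Matrix.blockDiagonal' P.A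

/-- `B = blkdiag(B_1, …, B_N)` -/
def jointB : Matrix ((k : Fin N) × Fin (P.d k)) ((k : Fin N) × Fin (P.m k)) ℝ :=
  Matrix.blockDiagonal' P.B

/-- `Q = blkdiag(Q_1, …, Q_N)` -/
def jointQ : Matrix ((k : Fin N) × Fin (P.d k)) ((k : Fin N) × Fin (P.d k)) ℝ :=
  Matrix.blockDiagonal' P.Q

/-- `Q̂ = blkdiag(Q̂_1, …, Q̂_N)` -/
def jointQhat : Matrix ((k : Fin N) × Fin (P.d k)) ((k : Fin N) × Fin (P.d k)) ℝ :=
  Matrix.blockDiagonal' P.Qhat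

/-- `R = blkdiag(R_1, …, R_N)` -/
def jointR : Matrix ((k : Fin N) × Fin (P.m k)) ((k : Fin N) × Fin (P.m k)) ℝ :=
  Matrix.blockDiagonal' P.R

/-- The stacked initial state. -/
def jointInit : P.State := fun i => P.xbar i.1 i.2

/-- `λ'_k = ∑_{ℓ ≠ k} λ_ℓ` -/
def lamCompl (k : Fin N) : ℝ := ∑ l ∈ Finset.univ.erase k, P.lam l

/-- `λ̃ = ∑_k λ_k` -/
def lamTotal : ℝ := ∑ k, P.lam k

/-- The admissible actions: the union over `k` of `{0} × ⋯ × ℝ^{m_k} × ⋯ × {0}`. -/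
def admissibleActions : Set P.Control :=
  ⋃ k : Fin N, {w | ∀ l : Fin N, l ≠ k → block w l = 0}

/-- `∑_k λ_k 1_{{0}}(μᵏ)` -/
def sparsity (μ : P.Control) : ℝ :=
  ∑ k : Fin N, P.lam k * ({0} : Set (Fin (P.m k) → ℝ)).indicator (fun _ => (1 : ℝ)) (block μ k)

/-- The instantaneous cost `½(⟨ξ, Q ξ⟩ + ⟨μ, R μ⟩) - ∑_k λ_k 1_{{0}}(μᵏ)`. -/
def runningCost (ξ : P.State) (μ : P.Control) : ℝ :=
  1 / 2 * (ξ ⬝ᵥ (P.jointQ *ᵥ ξ) + μ ⬝ᵥ (P.jointR *ᵥ μ)) - P.sparsity μ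

open Classical in
/-- The objective. The instantaneous cost along a process is measurable and bounded below, so its
integral over `[0, T]` is `+∞` when it is not integrable. -/
def cost (x : ℝ → P.State) (u : ℝ → P.Control) : EReal :=
  if IntegrableOn (fun t => P.runningCost (x t) (u t)) (Icc 0 P.T) then
    (((∫ t in Icc 0 P.T, P.runningCost (x t) (u t))
      + 1 / 2 * (x P.T ⬝ᵥ (P.jointQhat *ᵥ x P.T)) : ℝ) : EReal)
  else ⊤

/-- `t ↦ (x t, u t)` on `[0, T]` satisfies all constraints: `u` is Lebesgue measurable with
admissible values and `x` is an absolutely continuous (Carathéodory) solution of `ẋ = A x + B u`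
with the given initial value. Values outside `[0, T]` are irrelevant. -/
structure IsAdmissible (x : ℝ → P.State) (u : ℝ → P.Control) : Prop where
  measurable : AEMeasurable u (volume.restrict (Icc 0 P.T))
  mem : ∀ t ∈ Icc 0 P.T, u t ∈ P.admissibleActions
  absCont : AbsolutelyContinuousOnInterval x 0 P.T
  ode : ∀ᵐ t ∂(volume.restrict (Icc 0 P.T)),
    HasDerivAt x (P.jointA *ᵥ x t + P.jointB *ᵥ u t) t
  init : x 0 = P.jointInit

/-- Local minimizers: the cost is minimal among all processes whose state trajectory is uniformly
close to the given one. -/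
def IsLocalMinimizer (xs : ℝ → P.State) (us : ℝ → P.Control) : Prop :=
  P.IsAdmissible xs us ∧
    ∃ ε > 0, ∀ (x : ℝ → P.State) (u : ℝ → P.Control), P.IsAdmissible x u →
      (∀ t ∈ Icc 0 P.T, ‖x t - xs t‖ ≤ ε) → P.cost xs us ≤ P.cost x u

/-- `‖pᵏ‖²` in the norm weighted by `B_k R_k⁻¹ B_kᵀ`. -/
def adjNormSq (k : Fin N) (p : P.State) : ℝ :=
  weightedNorm (P.B k * (P.R k)⁻¹ * (P.B k)ᵀ) (block p k) ^ 2

/-- `R_k⁻¹ B_kᵀ pᵏ` -/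
def candidate (k : Fin N) (p : P.State) : Fin (P.m k) → ℝ :=
  (P.R k)⁻¹ *ᵥ ((P.B k)ᵀ *ᵥ block p k)

open Classical in
/-- The set of control values allowed for the system selected by the multiplexer. -/
def activeSet (k : Fin N) (p : P.State) : Set (Fin (P.m k) → ℝ) :=
  if 2 * P.lam k < P.adjNormSq k p then {P.candidate k p}
  else if P.adjNormSq k p = 2 * P.lam k then {0} ∪ {P.candidate k p}
  else {0}

open Classical in
/-- The quantity maximized over `k` by the multiplexer. -/
def muxValue (p : P.State) (k : Fin N) : ℝ :=
  if 2 * P.lam k ≤ P.adjNormSq k p then P.lamCompl k + 1 / 2 * P.adjNormSq k p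
  else P.lamTotal

/-- `⟨p, A ξ + B μ⟩ + ∑_k λ_k 1_{{0}}(μᵏ) - ½(⟨ξ, Q ξ⟩ + ⟨μ, R μ⟩)` -/
def hamiltonian (p ξ : P.State) (μ : P.Control) : ℝ :=
  p ⬝ᵥ (P.jointA *ᵥ ξ + P.jointB *ᵥ μ) + P.sparsity μ
    - 1 / 2 * (ξ ⬝ᵥ (P.jointQ *ᵥ ξ) + μ ⬝ᵥ (P.jointR *ᵥ μ))

end MuxLQ

end

/-! The dynamics are linear and the state enters the cost quadratically, so the cost of any
competitor expands exactly. Integrating the derivative of ⟨p, x - xs⟩, with p the adjoint state,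
gives `realCost_eq`: the cost difference is the integral of K(p, us) - K(p, u), where K is the
control-dependent part of the Hamiltonian, plus quadratic terms in x - xs. No continuity of K in the
control is needed, so the indicator terms do no harm.

Replace us by a bounded v on a small set E where us is bounded and v gains at least δ > 0 in K. The
state moves by O(|E|), so the cost changes by at most -δ|E| + O(|E|²), which is negative for small
|E| > 0. Hence K(p, v) ≤ K(p, us) a.e. for every bounded admissible v
(`IsLocalMinimizer.controlHamiltonian_le`). The comparison needs a finite minimal cost, which
truncating the control provides.

Only N + 1 competitors matter: v = 0 and the N candidates. By completing the square, the maximum of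
K over actions supported in block k is `muxValue`, and an action at least as good as these
competitors has the asserted form (`maximum_condition`). The multiplexer σ is a measurable choice of
the nonzero block of us.

For constancy, the maximized Hamiltonian depends only on x and p, so it is absolutely continuous. It
touches from above the Hamiltonian with control frozen at us(t), whose derivative at t vanishes by
the canonical equations; so its own derivative is zero a.e. -/

noncomputable section

/-! ### Calculus of absolutely continuous functions. -/

namespace AbsolutelyContinuousOnInterval

variable {X Y : Type*} [PseudoMetricSpace X] [PseudoMetricSpace Y] {a b : ℝ}

theorem _root_.LipschitzWith.comp_absolutelyContinuousOnInterval {K : NNReal} {g : X → Y}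
    {f : ℝ → X} (hg : LipschitzWith K g) (hf : AbsolutelyContinuousOnInterval f a b) :
    AbsolutelyContinuousOnInterval (fun t => g (f t)) a b := by
  refine squeeze_zero (fun t => Finset.sum_nonneg fun i _ => dist_nonneg) (fun t => ?_)
    (by simpa using Filter.Tendsto.const_mul (K : ℝ) hf)
  rw [Finset.mul_sum]
  exact Finset.sum_le_sum fun i _ => hg.dist_le_mul _ _

variable {ι : Type*} [Fintype ι]

theorem apply {f : ℝ → ι → ℝ} (hf : AbsolutelyContinuousOnInterval f a b) (i : ι) :
    AbsolutelyContinuousOnInterval (fun t => f t i) a b := by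
  have h : LipschitzWith 1 (fun v : ι → ℝ => v i) := LipschitzWith.eval i
  exact h.comp_absolutelyContinuousOnInterval hf

theorem const (c : X) : AbsolutelyContinuousOnInterval (fun _ : ℝ => c) a b :=
  (LipschitzWith.const c).lipschitzOnWith.absolutelyContinuousOnInterval

theorem finset_sum {κ : Type*} (s : Finset κ) {f : κ → ℝ → ℝ}
    (hf : ∀ i ∈ s, AbsolutelyContinuousOnInterval (f i) a b) :
    AbsolutelyContinuousOnInterval (fun t => ∑ i ∈ s, f i t) a b := by
  classical
  induction s using Finset.induction_on with
  | empty => simpa using const (0 : ℝ)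
  | insert i s hi ih =>
    simp only [Finset.sum_insert hi]
    exact (hf i (by simp)).fun_add (ih fun j hj => hf j (by simp [hj]))

theorem pi {f : ℝ → ι → ℝ} (hf : ∀ i, AbsolutelyContinuousOnInterval (fun t => f t i) a b) :
    AbsolutelyContinuousOnInterval f a b := by
  have h : Filter.Tendsto (fun E : ℕ × (ℕ → ℝ × ℝ) => ∑ i : ι,
      ∑ j ∈ Finset.range E.1, dist (f (E.2 j).1 i) (f (E.2 j).2 i))
      (totalLengthFilter ⊓ Filter.principal (disjWithin a b)) (nhds 0) := by
    have := tendsto_finsetSum (Finset.univ : Finset ι) (fun i _ => hf i)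
    simpa using this
  refine squeeze_zero (fun t => Finset.sum_nonneg fun i _ => dist_nonneg) (fun t => ?_) h
  rw [Finset.sum_comm]
  refine Finset.sum_le_sum fun j _ => ?_
  refine (dist_pi_le_iff (Finset.sum_nonneg fun i _ => dist_nonneg)).2 fun i => ?_
  exact Finset.single_le_sum (f := fun i => dist (f (t.2 j).1 i) (f (t.2 j).2 i))
    (fun i _ => dist_nonneg) (Finset.mem_univ i)

theorem dotProduct {f g : ℝ → ι → ℝ} (hf : AbsolutelyContinuousOnInterval f a b)
    (hg : AbsolutelyContinuousOnInterval g a b) :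
    AbsolutelyContinuousOnInterval (fun t => f t ⬝ᵥ g t) a b := by
  have h : ∀ i ∈ Finset.univ, AbsolutelyContinuousOnInterval (fun t => f t i * g t i) a b :=
    fun i _ => (hf.apply i).fun_mul (hg.apply i)
  exact finset_sum _ h

theorem mulVec {κ : Type*} [Fintype κ] (M : Matrix κ ι ℝ) {f : ℝ → ι → ℝ}
    (hf : AbsolutelyContinuousOnInterval f a b) :
    AbsolutelyContinuousOnInterval (fun t => M *ᵥ f t) a b :=
  pi fun i => (const (M i)).dotProduct hf

theorem clm_apply {κ : Type*} [Fintype κ] {Φ : ℝ → (ι → ℝ) →L[ℝ] (κ → ℝ)} {f : ℝ → ι → ℝ}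
    (hΦ : AbsolutelyContinuousOnInterval Φ a b) (hf : AbsolutelyContinuousOnInterval f a b) :
    AbsolutelyContinuousOnInterval (fun t => Φ t (f t)) a b := by
  classical
  refine pi fun k => ?_
  -- Expanding in the standard basis reduces the claim to products of scalar functions.
  have h : (fun t => Φ t (f t) k) = fun t => ∑ i, f t i * Φ t (Pi.single i 1) k := by
    ext t
    conv_lhs => rw [pi_eq_sum_univ' (f t)]
    simp [map_sum, Finset.sum_apply]
  rw [h]
  refine finset_sum _ fun i _ => (hf.apply i).fun_mul ?_
  have h1 : AbsolutelyContinuousOnInterval (fun t => Φ t (Pi.single i (1 : ℝ))) a b :=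
    (ContinuousLinearMap.apply ℝ (κ → ℝ)
      (Pi.single i (1 : ℝ) : ι → ℝ)).lipschitz.comp_absolutelyContinuousOnInterval hΦ
  exact h1.apply k

/-- Fundamental theorem of calculus with the derivative given almost everywhere. -/
theorem integral_eq_sub_of_ae_hasDerivAt {f f' : ℝ → ℝ} (hab : a ≤ b)
    (hf : AbsolutelyContinuousOnInterval f a b)
    (hf' : ∀ᵐ t ∂(volume.restrict (Icc a b)), HasDerivAt f (f' t) t) :
    IntegrableOn f' (Icc a b) ∧ ∫ t in Icc a b, f' t = f b - f a := by
  have he : deriv f =ᵐ[volume.restrict (Icc a b)] f' := hf'.mono fun t ht => ht.deriv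
  have hi : IntegrableOn (deriv f) (Icc a b) := by
    have := hf.intervalIntegrable_deriv
    rwa [intervalIntegrable_iff_integrableOn_Icc_of_le hab] at this
  refine ⟨hi.congr he, ?_⟩
  rw [← integral_congr_ae he, ← hf.integral_deriv_eq_sub,
    intervalIntegral.integral_of_le hab, integral_Icc_eq_integral_Ioc]

theorem integrableOn_of_ae_hasDerivAt {f f' : ℝ → ι → ℝ} (hab : a ≤ b)
    (hf : AbsolutelyContinuousOnInterval f a b)
    (hf' : ∀ᵐ t ∂(volume.restrict (Icc a b)), HasDerivAt f (f' t) t) :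
    IntegrableOn f' (Icc a b) :=
  Integrable.of_eval fun i => ((hf.apply i).integral_eq_sub_of_ae_hasDerivAt hab
    (hf'.mono fun _ ht => (hasDerivAt_pi.1 ht) i)).1

end AbsolutelyContinuousOnInterval

/-! ### Linear ODEs with integrable forcing. -/

section LinearODE

variable {ι : Type*} [Fintype ι]

/-- The flow `t ↦ exp (t L)` of a continuous linear vector field. -/
def linearFlow (L : (ι → ℝ) →L[ℝ] (ι → ℝ)) (t : ℝ) : (ι → ℝ) →L[ℝ] (ι → ℝ) :=
  NormedSpace.exp (t • L)

theorem hasDerivAt_linearFlow (L : (ι → ℝ) →L[ℝ] (ι → ℝ)) (t : ℝ) :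
    HasDerivAt (linearFlow L) (L * linearFlow L t) t :=
  hasDerivAt_exp_smul_const' L t

theorem linearFlow_zero (L : (ι → ℝ) →L[ℝ] (ι → ℝ)) : linearFlow L 0 = 1 := by
  simp [linearFlow]

theorem linearFlow_mul_neg (L : (ι → ℝ) →L[ℝ] (ι → ℝ)) (t : ℝ) :
    linearFlow L t * linearFlow L (-t) = 1 := by
  let _ := NormedAlgebra.restrictScalars ℚ ℝ ((ι → ℝ) →L[ℝ] (ι → ℝ))
  have h := NormedSpace.exp_add_of_commute (Commute.neg_right (Commute.refl (t • L)))
  rw [add_neg_cancel, NormedSpace.exp_zero] at h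
  rw [linearFlow, linearFlow, neg_smul t L]
  exact h.symm

theorem continuous_linearFlow (L : (ι → ℝ) →L[ℝ] (ι → ℝ)) : Continuous (linearFlow L) :=
  continuous_iff_continuousAt.2 fun t => (hasDerivAt_linearFlow L t).continuousAt

theorem absolutelyContinuousOnInterval_linearFlow (L : (ι → ℝ) →L[ℝ] (ι → ℝ)) (a b : ℝ) :
    AbsolutelyContinuousOnInterval (linearFlow L) a b := by
  refine ContDiffOn.absolutelyContinuousOnInterval (ContDiff.contDiffOn ?_)
  rw [contDiff_one_iff_deriv]
  refine ⟨fun t => (hasDerivAt_linearFlow L t).differentiableAt, ?_⟩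
  rw [funext fun t => (hasDerivAt_linearFlow L t).deriv]
  exact continuous_const.mul (continuous_linearFlow L)

/-- The variation of constants formula. -/
def linearSolution (L : (ι → ℝ) →L[ℝ] (ι → ℝ)) (f : ℝ → ι → ℝ) (c : ι → ℝ) (t : ℝ) : ι → ℝ :=
  linearFlow L t (c + fun i => ∫ s in (0 : ℝ)..t, linearFlow L (-s) (f s) i)

/-- The interval is symmetric because variation of constants uses the flow both at t and at -s. -/
theorem exists_linearFlow_bound (L : (ι → ℝ) →L[ℝ] (ι → ℝ)) (T : ℝ) :
    ∃ K, 0 ≤ K ∧ ∀ t ∈ Icc (-T) T, ‖linearFlow L t‖ ≤ K := by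
  obtain ⟨K, hK⟩ := isCompact_Icc.exists_bound_of_continuousOn
    (s := Icc (-T) T) (continuous_linearFlow L).continuousOn
  exact ⟨max K 0, le_max_right _ _, fun t ht => (hK t ht).trans (le_max_left _ _)⟩

variable {L : (ι → ℝ) →L[ℝ] (ι → ℝ)} {T : ℝ} {f : ℝ → ι → ℝ}

theorem integrableOn_linearFlow_neg (hf : IntegrableOn f (Icc 0 T)) :
    IntegrableOn (fun s => linearFlow L (-s) (f s)) (Icc 0 T) := by
  obtain ⟨K, hK0, hK⟩ := exists_linearFlow_bound L T
  refine Integrable.mono' (hf.norm.const_mul K) ?_ ?_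
  · exact (ContinuousLinearMap.id ℝ ((ι → ℝ) →L[ℝ] (ι → ℝ))).aestronglyMeasurable_comp₂
      ((continuous_linearFlow L).comp continuous_neg).aestronglyMeasurable hf.1
  · filter_upwards [ae_restrict_mem measurableSet_Icc] with s hs
    exact ((linearFlow L (-s)).le_opNorm _).trans
      (mul_le_mul_of_nonneg_right (hK _ ⟨by linarith [hs.2], by linarith [hs.1, hs.2]⟩)
        (norm_nonneg _))

theorem intervalIntegrable_linearFlow_neg (hT : 0 ≤ T) (hf : IntegrableOn f (Icc 0 T)) (i : ι) :
    IntervalIntegrable (fun s => linearFlow L (-s) (f s) i) volume 0 T := by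
  rw [intervalIntegrable_iff_integrableOn_Icc_of_le hT]
  exact (integrableOn_linearFlow_neg hf).eval i

theorem linearSolution_absolutelyContinuousOnInterval (hT : 0 ≤ T)
    (hf : IntegrableOn f (Icc 0 T)) (c : ι → ℝ) :
    AbsolutelyContinuousOnInterval (linearSolution L f c) 0 T := by
  refine (absolutelyContinuousOnInterval_linearFlow L 0 T).clm_apply
    ((AbsolutelyContinuousOnInterval.const c).fun_add (.pi fun i => ?_))
  exact (intervalIntegrable_linearFlow_neg hT hf i).absolutelyContinuousOnInterval_intervalIntegral
    left_mem_uIcc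

theorem linearSolution_ae_hasDerivAt (hT : 0 ≤ T) (hf : IntegrableOn f (Icc 0 T)) (c : ι → ℝ) :
    ∀ᵐ t ∂(volume.restrict (Icc 0 T)),
      HasDerivAt (linearSolution L f c) (L (linearSolution L f c t) + f t) t := by
  have h : ∀ᵐ t, ∀ i, t ∈ uIcc 0 T → HasDerivAt
      (fun t => ∫ s in (0 : ℝ)..t, linearFlow L (-s) (f s) i) (linearFlow L (-t) (f t) i) t := by
    rw [ae_all_iff]
    intro i
    filter_upwards [(intervalIntegrable_linearFlow_neg (L := L) hT hf i).ae_hasDerivAt_integral]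
      with t ht hm
    exact ht hm 0 left_mem_uIcc
  filter_upwards [ae_restrict_of_ae h, ae_restrict_mem measurableSet_Icc] with t ht hm
  have h1 : HasDerivAt (fun t => c + fun i => ∫ s in (0 : ℝ)..t, linearFlow L (-s) (f s) i)
      (linearFlow L (-t) (f t)) t :=
    (hasDerivAt_pi.2 fun i => ht i (by rwa [uIcc_of_le hT])).const_add c
  have h2 := (hasDerivAt_linearFlow L t).clm_apply h1
  have h3 : linearFlow L t (linearFlow L (-t) (f t)) = f t := by
    rw [← mul_apply_eq_comp, linearFlow_mul_neg]; rfl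
  rw [h3] at h2
  exact h2

theorem linearSolution_zero (c : ι → ℝ) : linearSolution L f c 0 = c := by
  simp only [linearSolution, intervalIntegral.integral_same, linearFlow_zero]
  ext i; simp

/-- Existence for linear ODEs with integrable forcing and zero initial value, with an a priori
bound. -/
theorem exists_linearODE_bound (L : (ι → ℝ) →L[ℝ] (ι → ℝ)) (hT : 0 ≤ T) :
    ∃ C, 0 ≤ C ∧ ∀ f : ℝ → ι → ℝ, IntegrableOn f (Icc 0 T) →
      ∃ y : ℝ → ι → ℝ, AbsolutelyContinuousOnInterval y 0 T ∧ y 0 = 0 ∧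
        (∀ᵐ t ∂(volume.restrict (Icc 0 T)), HasDerivAt y (L (y t) + f t) t) ∧
        ∀ t ∈ Icc 0 T, ‖y t‖ ≤ C * ∫ s in Icc 0 T, ‖f s‖ := by
  obtain ⟨K, hK0, hK⟩ := exists_linearFlow_bound L T
  refine ⟨K * K, mul_nonneg hK0 hK0, fun f hf => ⟨linearSolution L f 0,
    linearSolution_absolutelyContinuousOnInterval hT hf 0, linearSolution_zero 0,
    linearSolution_ae_hasDerivAt hT hf 0, fun t ht => ?_⟩⟩
  have hint : (0 : ℝ) ≤ ∫ s in Icc 0 T, ‖f s‖ := integral_nonneg fun _ => norm_nonneg _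
  refine ((linearFlow L t).le_opNorm _).trans ?_
  rw [mul_assoc]
  refine mul_le_mul (hK t ⟨by linarith [ht.1, ht.2], ht.2⟩) ?_ (norm_nonneg _) hK0
  rw [zero_add]
  refine (pi_norm_le_iff_of_nonneg (mul_nonneg hK0 hint)).2 fun i => ?_
  rw [intervalIntegral.integral_of_le ht.1, ← integral_const_mul,
    ← integral_Icc_eq_integral_Ioc]
  refine (norm_integral_le_integral_norm _).trans ?_
  have hsub : Icc 0 t ⊆ Icc 0 T := Icc_subset_Icc_right ht.2
  have hf1 : IntegrableOn (fun s => ‖linearFlow L (-s) (f s) i‖) (Icc 0 T) :=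
    ((integrableOn_linearFlow_neg hf).eval i).norm
  have hf2 : IntegrableOn (fun s => K * ‖f s‖) (Icc 0 T) := hf.norm.const_mul K
  refine (setIntegral_mono_on (hf1.mono_set hsub)
    (hf2.mono_set hsub) measurableSet_Icc fun s hs => ?_).trans
    (setIntegral_mono_set hf2
      (.of_forall fun s => mul_nonneg hK0 (norm_nonneg _)) hsub.eventuallyLE)
  refine (norm_le_pi_norm _ i).trans (((linearFlow L (-s)).le_opNorm _).trans
    (mul_le_mul_of_nonneg_right (hK _ ⟨?_, ?_⟩) (norm_nonneg _))) <;>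
  linarith [hs.1, hs.2, ht.2]

/-- Existence for linear ODEs with integrable forcing and prescribed terminal value. -/
theorem exists_linearODE_terminal (L : (ι → ℝ) →L[ℝ] (ι → ℝ)) (hT : 0 ≤ T)
    (hf : IntegrableOn f (Icc 0 T)) (c : ι → ℝ) :
    ∃ y : ℝ → ι → ℝ, AbsolutelyContinuousOnInterval y 0 T ∧ y T = c ∧
      ∀ᵐ t ∂(volume.restrict (Icc 0 T)), HasDerivAt y (L (y t) + f t) t := by
  refine ⟨linearSolution L f
    (linearFlow L (-T) c - fun i => ∫ s in (0 : ℝ)..T, linearFlow L (-s) (f s) i),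
    linearSolution_absolutelyContinuousOnInterval hT hf _, ?_,
    linearSolution_ae_hasDerivAt hT hf _⟩
  rw [linearSolution, sub_add_cancel, ← mul_apply_eq_comp, linearFlow_mul_neg]
  rfl

end LinearODE

/-! ### Block structure and pointwise maximization of the Hamiltonian. -/

namespace MuxLQ

section Blocks

variable {N : ℕ}

theorem dotProduct_eq_sum_block {n : Fin N → ℕ} (v w : ((k : Fin N) × Fin (n k)) → ℝ) :
    v ⬝ᵥ w = ∑ k, block v k ⬝ᵥ block w k := by
  simp only [dotProduct, Fintype.sum_sigma, block]

theorem block_blockDiagonal'_mulVec {n n' : Fin N → ℕ}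
    (M : ∀ k, Matrix (Fin (n k)) (Fin (n' k)) ℝ) (v : ((k : Fin N) × Fin (n' k)) → ℝ)
    (k : Fin N) : block (Matrix.blockDiagonal' M *ᵥ v) k = M k *ᵥ block v k := by
  ext i
  simp only [block, Matrix.mulVec, dotProduct, Fintype.sum_sigma]
  rw [Finset.sum_eq_single k]
  · simp [Matrix.blockDiagonal'_apply_eq]
  · intro l _ hl
    simp [Matrix.blockDiagonal'_apply_ne M _ _ hl.symm]
  · simp

/-- The stacked vector with block `w` at position `k` and zeros elsewhere. -/
def embed {n : Fin N → ℕ} (k : Fin N) (w : Fin (n k) → ℝ) : ((k : Fin N) × Fin (n k)) → ℝ :=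
  fun i => Function.update (0 : ∀ l, Fin (n l) → ℝ) k w i.1 i.2

theorem block_embed_self {n : Fin N → ℕ} (k : Fin N) (w : Fin (n k) → ℝ) :
    block (embed k w) k = w := by
  ext i; simp [block, embed]

theorem block_embed_of_ne {n : Fin N → ℕ} {k l : Fin N} (h : l ≠ k) (w : Fin (n k) → ℝ) :
    block (embed k w) l = 0 := by
  ext i; simp [block, embed, h]

theorem norm_embed {n : Fin N → ℕ} (k : Fin N) (w : Fin (n k) → ℝ) :
    ‖(embed k w : ((k : Fin N) × Fin (n k)) → ℝ)‖ ≤ ‖w‖ := by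
  refine (pi_norm_le_iff_of_nonneg (norm_nonneg _)).2 ?_
  rintro ⟨l, i⟩
  by_cases h : l = k
  · subst h; simpa [embed] using norm_le_pi_norm w i
  · simp [embed, h]

end Blocks

variable {N : ℕ} (P : MuxLQ N)

/-- The part of the Hamiltonian that depends on the control. -/
def controlHamiltonian (p : P.State) (μ : P.Control) : ℝ :=
  p ⬝ᵥ (P.jointB *ᵥ μ) + P.sparsity μ - 1 / 2 * (μ ⬝ᵥ (P.jointR *ᵥ μ))

theorem hamiltonian_eq (p ξ : P.State) (μ : P.Control) :
    P.hamiltonian p ξ μ =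
      p ⬝ᵥ (P.jointA *ᵥ ξ) - 1 / 2 * (ξ ⬝ᵥ (P.jointQ *ᵥ ξ)) + P.controlHamiltonian p μ := by
  simp only [hamiltonian, controlHamiltonian, dotProduct_add]; ring

theorem jointQ_isSymm : (P.jointQ).IsSymm := by
  rw [Matrix.IsSymm, jointQ, Matrix.blockDiagonal'_transpose]
  congr 1; ext1 k
  simpa using (P.Q_posSemidef k).isHermitian.eq

theorem jointQhat_isSymm : (P.jointQhat).IsSymm := by
  rw [Matrix.IsSymm, jointQhat, Matrix.blockDiagonal'_transpose]
  congr 1; ext1 k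
  simpa using (P.Qhat_posSemidef k).isHermitian.eq

theorem R_isSymm (k : Fin N) : (P.R k)ᵀ = P.R k := by
  simpa using (P.R_posDef k).isHermitian.eq

theorem R_mulVec_candidate (k : Fin N) (p : P.State) :
    P.R k *ᵥ P.candidate k p = (P.B k)ᵀ *ᵥ block p k := by
  rw [candidate, Matrix.mulVec_mulVec,
    Matrix.mul_nonsing_inv _ ((Matrix.isUnit_iff_isUnit_det _).1 (P.R_posDef k).isUnit),
    Matrix.one_mulVec]

/-- Positivity of R makes the radicand nonnegative, so the square undoes the root; the right side is
the constant produced by completing the square. -/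
theorem adjNormSq_eq (k : Fin N) (p : P.State) :
    P.adjNormSq k p = P.candidate k p ⬝ᵥ (P.R k *ᵥ P.candidate k p) := by
  have h : block p k ⬝ᵥ ((P.B k * (P.R k)⁻¹ * (P.B k)ᵀ) *ᵥ block p k)
      = P.candidate k p ⬝ᵥ (P.R k *ᵥ P.candidate k p) := by
    rw [R_mulVec_candidate, ← Matrix.mulVec_mulVec, ← Matrix.mulVec_mulVec,
      Matrix.dotProduct_mulVec, dotProduct_comm, Matrix.mulVec_transpose,
      candidate, Matrix.mulVec_transpose]
  rw [adjNormSq, weightedNorm, h, Real.sq_sqrt]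
  simpa using (P.R_posDef k).posSemidef.dotProduct_mulVec_nonneg (P.candidate k p)

/-- Every inactive block collects its full reward, which adds up to `lamCompl`; only block k is left
to optimize. -/
theorem controlHamiltonian_eq_of_block {k : Fin N} {μ : P.Control}
    (hμ : ∀ l, l ≠ k → block μ l = 0) (p : P.State) :
    P.controlHamiltonian p μ =
      block p k ⬝ᵥ (P.B k *ᵥ block μ k) - 1 / 2 * (block μ k ⬝ᵥ (P.R k *ᵥ block μ k))
        + P.lamCompl k
        + P.lam k * ({0} : Set (Fin (P.m k) → ℝ)).indicator (fun _ => (1 : ℝ)) (block μ k) := by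
  have h1 : p ⬝ᵥ (P.jointB *ᵥ μ) = block p k ⬝ᵥ (P.B k *ᵥ block μ k) := by
    rw [dotProduct_eq_sum_block, Finset.sum_eq_single k]
    · rw [jointB, block_blockDiagonal'_mulVec]
    · intro l _ hl
      rw [jointB, block_blockDiagonal'_mulVec, hμ l hl]; simp
    · simp
  have h2 : μ ⬝ᵥ (P.jointR *ᵥ μ) = block μ k ⬝ᵥ (P.R k *ᵥ block μ k) := by
    rw [dotProduct_eq_sum_block, Finset.sum_eq_single k]
    · rw [jointR, block_blockDiagonal'_mulVec]
    · intro l _ hl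
      rw [hμ l hl]; simp
    · simp
  have h3 : P.sparsity μ = P.lamCompl k
      + P.lam k * ({0} : Set (Fin (P.m k) → ℝ)).indicator (fun _ => (1 : ℝ)) (block μ k) := by
    rw [sparsity, lamCompl, ← Finset.sum_erase_add _ _ (Finset.mem_univ k)]
    congr 1
    refine Finset.sum_congr rfl fun l hl => ?_
    rw [hμ l (Finset.ne_of_mem_erase hl)]; simp
  rw [controlHamiltonian, h1, h2, h3]; ring

/-- Completing the square. -/
theorem linear_sub_quadratic_eq (k : Fin N) (p : P.State) (w : Fin (P.m k) → ℝ) :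
    block p k ⬝ᵥ (P.B k *ᵥ w) - 1 / 2 * (w ⬝ᵥ (P.R k *ᵥ w)) =
      1 / 2 * P.adjNormSq k p
        - 1 / 2 * ((w - P.candidate k p) ⬝ᵥ (P.R k *ᵥ (w - P.candidate k p))) := by
  have h1 : block p k ⬝ᵥ (P.B k *ᵥ w) = w ⬝ᵥ (P.R k *ᵥ P.candidate k p) := by
    rw [R_mulVec_candidate, Matrix.dotProduct_mulVec, Matrix.mulVec_transpose, dotProduct_comm]
  have h2 : P.candidate k p ⬝ᵥ (P.R k *ᵥ w) = w ⬝ᵥ (P.R k *ᵥ P.candidate k p) := by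
    rw [Matrix.dotProduct_mulVec, ← Matrix.mulVec_transpose, R_isSymm, dotProduct_comm]
  rw [h1, adjNormSq_eq, Matrix.mulVec_sub, dotProduct_sub, sub_dotProduct, sub_dotProduct, h2]
  ring

theorem lamCompl_add (k : Fin N) : P.lamCompl k + P.lam k = P.lamTotal :=
  Finset.sum_erase_add _ _ (Finset.mem_univ k)

/-- The threshold 2λ_k is exactly where the two branches cross, since λ̃ = λ'_k + λ_k. As a maximum,
the value inherits absolute continuity along p. -/
theorem muxValue_eq_max (p : P.State) (k : Fin N) :
    P.muxValue p k = max P.lamTotal (P.lamCompl k + 1 / 2 * P.adjNormSq k p) := by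
  have := P.lamCompl_add k
  unfold muxValue
  split_ifs with h
  · rw [max_eq_right]; linarith
  · rw [max_eq_left]; linarith

theorem controlHamiltonian_le {k : Fin N} {μ : P.Control}
    (hμ : ∀ l, l ≠ k → block μ l = 0) (p : P.State) :
    P.controlHamiltonian p μ ≤ P.muxValue p k := by
  rw [P.controlHamiltonian_eq_of_block hμ, muxValue_eq_max]
  by_cases h : block μ k = 0
  · refine le_max_of_le_left ?_
    rw [h]
    simp [P.lamCompl_add k]
  · refine le_max_of_le_right ?_
    rw [linear_sub_quadratic_eq]
    have h0 := (P.R_posDef k).posSemidef.dotProduct_mulVec_nonneg (block μ k - P.candidate k p)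
    simp only [star_trivial] at h0
    rw [indicator_of_notMem (by simpa using h)]
    linarith

theorem controlHamiltonian_zero (p : P.State) : P.controlHamiltonian p 0 = P.lamTotal := by
  have h : ∀ k, block (0 : P.Control) k = 0 := fun k => rfl
  simp [controlHamiltonian, sparsity, h, lamTotal]

/-- Only an inequality: a candidate equal to zero also earns the reward λ_k. -/
theorem le_controlHamiltonian_embed (p : P.State) (k : Fin N) :
    P.lamCompl k + 1 / 2 * P.adjNormSq k p
      ≤ P.controlHamiltonian p (embed k (P.candidate k p)) := by
  rw [P.controlHamiltonian_eq_of_block (fun l hl => block_embed_of_ne hl _), block_embed_self,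
    linear_sub_quadratic_eq]
  have : 0 ≤ P.lam k * ({0} : Set (Fin (P.m k) → ℝ)).indicator (fun _ => (1 : ℝ))
      (P.candidate k p) :=
    mul_nonneg (P.lam_pos k).le (indicator_nonneg (fun _ _ => zero_le_one) _)
  simp only [sub_self, zero_dotProduct, mul_zero, sub_zero]
  linarith

/-- Measurable selection of the index of a nonzero block. -/
theorem exists_measurable_activeIndex : ∃ s : P.Control → Fin N, Measurable s ∧
    ∀ μ ∈ P.admissibleActions, ∀ l, l ≠ s μ → block μ l = 0 := by
  classical
  have hblock : ∀ k : Fin N, MeasurableSet {μ : P.Control | block μ k ≠ 0} := fun k =>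
    (measurable_pi_lambda _ fun _ => measurable_pi_apply _ :
      Measurable fun μ : P.Control => block μ k) (measurableSet_singleton 0).compl
  have hsel : ∀ K : Finset (Fin N), ∃ s : P.Control → Fin N, Measurable s ∧
      ∀ μ, (∃ k ∈ K, block μ k ≠ 0) → block μ (s μ) ≠ 0 := by
    intro K
    induction K using Finset.induction_on with
    | empty => exact ⟨fun _ => ⟨0, P.N_pos⟩, measurable_const, by simp⟩
    | insert k K _ ih =>
      obtain ⟨s, hs, hs'⟩ := ih
      refine ⟨fun μ => if block μ k ≠ 0 then k else s μ, .ite (hblock k) measurable_const hs, ?_⟩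
      rintro μ ⟨l, hl, hne⟩
      by_cases hk : block μ k ≠ 0
      · beta_reduce
        rw [if_pos hk]
        exact hk
      · beta_reduce
        rw [if_neg hk]
        rcases Finset.mem_insert.1 hl with rfl | hl
        · exact absurd hne hk
        · exact hs' μ ⟨l, hl, hne⟩
  obtain ⟨s, hs, hs'⟩ := hsel Finset.univ
  refine ⟨s, hs, fun μ hμ l hl => ?_⟩
  -- An admissible action has at most one nonzero block, so any nonzero block found is the only one;
  -- for the zero action every index will do.
  obtain ⟨k, hk⟩ := mem_iUnion.1 hμ
  by_contra h
  have h1 : s μ = k := by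
    by_contra h1
    exact hs' μ ⟨l, Finset.mem_univ l, h⟩ (hk _ h1)
  exact h (hk l (h1 ▸ hl))

/-- An admissible action that does at least as well as inactivity and as all candidates has the
form described by the maximum principle. -/
theorem maximum_condition {p : P.State} {μ : P.Control} {k : Fin N}
    (hμ : ∀ l, l ≠ k → block μ l = 0) (h0 : P.controlHamiltonian p 0 ≤ P.controlHamiltonian p μ)
    (hc : ∀ l, P.controlHamiltonian p (embed l (P.candidate l p)) ≤ P.controlHamiltonian p μ) :
    block μ k ∈ P.activeSet k p ∧ (∀ l, P.muxValue p l ≤ P.muxValue p k) ∧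
      P.controlHamiltonian p μ = P.muxValue p k := by
  rw [controlHamiltonian_zero] at h0
  have hc' := fun l => (P.le_controlHamiltonian_embed p l).trans (hc l)
  have hmax : ∀ l, P.muxValue p l ≤ P.controlHamiltonian p μ := fun l => by
    rw [muxValue_eq_max]; exact max_le h0 (hc' l)
  have hle := P.controlHamiltonian_le hμ p
  refine ⟨?_, fun l => (hmax l).trans hle, le_antisymm hle (hmax k)⟩
  have hk := hc' k
  have hlam := P.lamCompl_add k
  rw [P.controlHamiltonian_eq_of_block hμ, linear_sub_quadratic_eq] at hk h0
  by_cases h : block μ k = 0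
  -- Inactive block: being no worse than the candidate bounds the adjoint norm by the threshold.
  · have hn : P.adjNormSq k p ≤ 2 * P.lam k := by
      have h3 := P.linear_sub_quadratic_eq k p (block μ k)
      simp only [h, Matrix.mulVec_zero, dotProduct_zero, mul_zero, sub_zero] at h3
      rw [h, ← h3] at hk
      simp only [mem_singleton_iff, indicator_of_mem] at hk
      linarith
    rw [h, activeSet, if_neg (not_lt.2 hn)]
    split_ifs <;> simp
  -- Active block: no reward λ_k is earned, so `hk` forces the square to vanish, and `h0` puts the
  -- adjoint norm at or above the threshold.
  · rw [indicator_of_notMem (by simpa using h)] at hk h0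
    have hq := (P.R_posDef k).posSemidef.dotProduct_mulVec_nonneg (block μ k - P.candidate k p)
    simp only [star_trivial] at hq
    have hcand : block μ k = P.candidate k p := by
      by_contra hne
      have := (P.R_posDef k).dotProduct_mulVec_pos (sub_ne_zero.2 hne)
      simp only [star_trivial] at this
      linarith
    have hn : 2 * P.lam k ≤ P.adjNormSq k p := by linarith
    rw [activeSet]
    split_ifs with h1 h2
    · exact hcand
    · exact Or.inr hcand
    · exact absurd (le_antisymm (not_lt.1 h1) hn) h2

end MuxLQ

/-! ### Quadratic forms and sets of small measure. -/

section Auxiliary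

theorem exists_mulVec_bound {ι κ : Type*} [Fintype ι] [Fintype κ] (M : Matrix κ ι ℝ) :
    ∃ b, 0 ≤ b ∧ ∀ w, ‖M *ᵥ w‖ ≤ b * ‖w‖ :=
  ⟨‖(Matrix.mulVecLin M).toContinuousLinearMap‖, norm_nonneg _,
    (Matrix.mulVecLin M).toContinuousLinearMap.le_opNorm⟩

theorem exists_quadratic_bound {ι : Type*} [Fintype ι] (M : Matrix ι ι ℝ) :
    ∃ q, 0 ≤ q ∧ ∀ y, y ⬝ᵥ (M *ᵥ y) ≤ q * ‖y‖ ^ 2 := by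
  obtain ⟨b, hb, hM⟩ := exists_mulVec_bound M
  refine ⟨Fintype.card ι * b, by positivity, fun y => ?_⟩
  have h : ∀ i ∈ Finset.univ, y i * (M *ᵥ y) i ≤ b * ‖y‖ ^ 2 := fun i _ => by
    have h1 := norm_le_pi_norm y i
    have h2 := (norm_le_pi_norm (M *ᵥ y) i).trans (hM y)
    calc y i * (M *ᵥ y) i ≤ ‖y i‖ * ‖(M *ᵥ y) i‖ := by
          rw [← norm_mul]; exact Real.le_norm_self _
      _ ≤ ‖y‖ * (b * ‖y‖) := by gcongr
      _ = b * ‖y‖ ^ 2 := by ring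
  have := Finset.sum_le_card_nsmul _ _ _ h
  simpa [dotProduct, mul_assoc] using this

theorem dotProduct_mulVec_comm_of_isSymm {ι : Type*} [Fintype ι] {M : Matrix ι ι ℝ}
    (hM : M.IsSymm) (v w : ι → ℝ) : v ⬝ᵥ (M *ᵥ w) = w ⬝ᵥ (M *ᵥ v) := by
  rw [Matrix.dotProduct_mulVec, ← Matrix.mulVec_transpose, hM.eq, dotProduct_comm]

theorem dotProduct_mulVec_add_of_isSymm {ι : Type*} [Fintype ι] {M : Matrix ι ι ℝ}
    (hM : M.IsSymm) (v w : ι → ℝ) : (v + w) ⬝ᵥ (M *ᵥ (v + w)) =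
      v ⬝ᵥ (M *ᵥ v) + 2 * (w ⬝ᵥ (M *ᵥ v)) + w ⬝ᵥ (M *ᵥ w) := by
  rw [Matrix.mulVec_add, dotProduct_add, add_dotProduct, add_dotProduct,
    dotProduct_mulVec_comm_of_isSymm hM v w]
  ring

/-- A set of positive measure has subsets of arbitrarily small positive
measure. -/
theorem exists_measurable_subset_small {S : Set ℝ} {η : ℝ} (hS : MeasurableSet S)
    (hpos : volume S ≠ 0) (hη : 0 < η) :
    ∃ E ⊆ S, MeasurableSet E ∧ 0 < volume.real E ∧ volume.real E ≤ η := by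
  by_contra hcon
  push Not at hcon
  apply hpos
  -- Cut S along a grid of mesh η: if no piece had positive measure, S would be null.
  have hcover : S ⊆ ⋃ n : ℤ, S ∩ Ico (n * η) ((n + 1) * η) := by
    intro t ht
    refine mem_iUnion.2 ⟨⌊t / η⌋, ht, ?_, ?_⟩
    · exact (le_div_iff₀ hη).1 (Int.floor_le _)
    · exact (div_lt_iff₀ hη).1 (Int.lt_floor_add_one _)
  refine measure_mono_null hcover (measure_iUnion_null fun n => ?_)
  have hfin : volume (Ico ((n : ℝ) * η) ((n + 1) * η)) ≠ ⊤ := measure_Ico_lt_top.ne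
  have hfin' : volume (S ∩ Ico ((n : ℝ) * η) ((n + 1) * η)) ≠ ⊤ :=
    measure_ne_top_of_subset inter_subset_right hfin
  have hle : volume.real (S ∩ Ico ((n : ℝ) * η) ((n + 1) * η)) ≤ η := by
    refine (measureReal_mono inter_subset_right hfin).trans ?_
    rw [Real.volume_real_Ico_of_le (by nlinarith)]
    linarith
  have h0 : ¬ 0 < volume.real (S ∩ Ico ((n : ℝ) * η) ((n + 1) * η)) := fun h =>
    absurd hle (not_le.2 (hcon _ inter_subset_left (hS.inter measurableSet_Ico) h))
  exact (measureReal_eq_zero_iff hfin').1 (le_antisymm (not_lt.1 h0) measureReal_nonneg)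

/-- Controls are only a.e. measurable, so S is merely null measurable; a measurable subset of full
measure supplies the needle sets E. -/
theorem ae_restrict_notMem_of_forall_small {S : Set ℝ} {T η : ℝ}
    (hS : NullMeasurableSet S (volume.restrict (Icc 0 T))) (hη : 0 < η)
    (h : ∀ E ⊆ S ∩ Icc 0 T, MeasurableSet E → 0 < volume.real E → ¬ volume.real E ≤ η) :
    ∀ᵐ t ∂(volume.restrict (Icc 0 T)), t ∉ S := by
  rw [← measure_eq_zero_iff_ae_notMem]
  by_contra hne
  obtain ⟨F, hFS, hFm, hFae⟩ := hS.exists_measurable_subset_ae_eq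
  rw [← measure_congr hFae, Measure.restrict_apply hFm] at hne
  obtain ⟨E, hE, hEm, hpos, hle⟩ :=
    exists_measurable_subset_small (hFm.inter measurableSet_Icc) hne hη
  exact h E (hE.trans (inter_subset_inter_left _ hFS)) hEm hpos hle

end Auxiliary

/-! ### Measurability, competing processes and finiteness of the cost. -/

namespace MuxLQ

variable {N : ℕ} (P : MuxLQ N)

theorem zero_mem_admissibleActions : (0 : P.Control) ∈ P.admissibleActions :=
  mem_iUnion.2 ⟨⟨0, P.N_pos⟩, fun _ _ => rfl⟩

theorem embed_mem_admissibleActions (k : Fin N) (w : Fin (P.m k) → ℝ) :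
    (embed k w : P.Control) ∈ P.admissibleActions :=
  mem_iUnion.2 ⟨k, fun _ hl => block_embed_of_ne hl w⟩

theorem measurable_block {n : Fin N → ℕ} (k : Fin N) :
    Measurable fun w : ((k : Fin N) × Fin (n k)) → ℝ => block w k :=
  measurable_pi_lambda _ fun _ => measurable_pi_apply _

theorem continuous_block {n : Fin N → ℕ} (k : Fin N) :
    Continuous fun w : ((k : Fin N) × Fin (n k)) → ℝ => block w k :=
  continuous_pi fun _ => continuous_apply _

theorem continuous_embed {n : Fin N → ℕ} (k : Fin N) :
    Continuous fun w : Fin (n k) → ℝ => (embed k w : ((k : Fin N) × Fin (n k)) → ℝ) :=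
  have h : Continuous fun w : Fin (n k) → ℝ =>
      Function.update (0 : ∀ l, Fin (n l) → ℝ) k w := continuous_const.update k continuous_id
  continuous_pi fun i => (continuous_apply i.2).comp ((continuous_apply i.1).comp h)

theorem continuous_candidate (k : Fin N) : Continuous (P.candidate k) :=
  continuous_const.matrix_mulVec (continuous_const.matrix_mulVec (continuous_block k))

theorem measurable_sparsity : Measurable P.sparsity := by
  refine Finset.measurable_sum _ fun k _ => Measurable.const_mul ?_ _
  exact (measurable_const.indicator (measurableSet_singleton 0)).comp (measurable_block k)

theorem sparsity_nonneg (μ : P.Control) : 0 ≤ P.sparsity μ :=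
  Finset.sum_nonneg fun k _ =>
    mul_nonneg (P.lam_pos k).le (indicator_nonneg (fun _ _ => zero_le_one) _)

theorem sparsity_le (μ : P.Control) : P.sparsity μ ≤ P.lamTotal :=
  Finset.sum_le_sum fun k _ => mul_le_of_le_one_right (P.lam_pos k).le
    (indicator_apply_le' (fun _ => le_rfl) fun _ => zero_le_one)

theorem measurable_runningCost :
    Measurable fun z : P.State × P.Control => P.runningCost z.1 z.2 := by
  have h : Continuous fun z : P.State × P.Control =>
      1 / 2 * (z.1 ⬝ᵥ (P.jointQ *ᵥ z.1) + z.2 ⬝ᵥ (P.jointR *ᵥ z.2)) :=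
    continuous_const.mul
      ((continuous_fst.dotProduct (continuous_const.matrix_mulVec continuous_fst)).add
        (continuous_snd.dotProduct (continuous_const.matrix_mulVec continuous_snd)))
  exact h.measurable.sub (P.measurable_sparsity.comp measurable_snd)

theorem continuous_controlHamiltonian_smooth : Continuous fun z : P.State × P.Control =>
    z.1 ⬝ᵥ (P.jointB *ᵥ z.2) - 1 / 2 * (z.2 ⬝ᵥ (P.jointR *ᵥ z.2)) :=
  (continuous_fst.dotProduct (continuous_const.matrix_mulVec continuous_snd)).sub
    (continuous_const.mul
      (continuous_snd.dotProduct (continuous_const.matrix_mulVec continuous_snd)))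

theorem controlHamiltonian_eq_smooth (p : P.State) (μ : P.Control) :
    P.controlHamiltonian p μ =
      (p ⬝ᵥ (P.jointB *ᵥ μ) - 1 / 2 * (μ ⬝ᵥ (P.jointR *ᵥ μ))) + P.sparsity μ := by
  rw [controlHamiltonian]; ring

theorem measurable_controlHamiltonian :
    Measurable fun z : P.State × P.Control => P.controlHamiltonian z.1 z.2 := by
  simp only [controlHamiltonian_eq_smooth]
  exact P.continuous_controlHamiltonian_smooth.measurable.add
    (P.measurable_sparsity.comp measurable_snd)

theorem aemeasurable_controlHamiltonian {μ : Measure ℝ} {p : ℝ → P.State} {u : ℝ → P.Control}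
    (hp : AEMeasurable p μ) (hu : AEMeasurable u μ) :
    AEMeasurable (fun t => P.controlHamiltonian (p t) (u t)) μ := by
  have h := P.measurable_controlHamiltonian.comp_aemeasurable (hp.prodMk hu)
  exact h

theorem exists_controlHamiltonian_bound (a b : ℝ) :
    ∃ c, ∀ p μ, ‖p‖ ≤ a → ‖μ‖ ≤ b → |P.controlHamiltonian p μ| ≤ c := by
  obtain ⟨c, hc⟩ := ((isCompact_closedBall (0 : P.State) a).prod
    (isCompact_closedBall (0 : P.Control) b)).exists_bound_of_continuousOn
    P.continuous_controlHamiltonian_smooth.continuousOn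
  refine ⟨c + P.lamTotal, fun p μ hp hμ => ?_⟩
  have h1 := hc (p, μ) ⟨by simpa using hp, by simpa using hμ⟩
  rw [controlHamiltonian_eq_smooth]
  refine (abs_add_le _ _).trans (add_le_add h1 ?_)
  rw [abs_of_nonneg (P.sparsity_nonneg μ)]
  exact P.sparsity_le μ

theorem exists_runningCost_bound (a b : ℝ) :
    ∃ c, ∀ ξ μ, ‖ξ‖ ≤ a → ‖μ‖ ≤ b → |P.runningCost ξ μ| ≤ c := by
  have h : Continuous fun z : P.State × P.Control =>
      1 / 2 * (z.1 ⬝ᵥ (P.jointQ *ᵥ z.1) + z.2 ⬝ᵥ (P.jointR *ᵥ z.2)) :=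
    continuous_const.mul
      ((continuous_fst.dotProduct (continuous_const.matrix_mulVec continuous_fst)).add
        (continuous_snd.dotProduct (continuous_const.matrix_mulVec continuous_snd)))
  obtain ⟨c, hc⟩ := ((isCompact_closedBall (0 : P.State) a).prod
    (isCompact_closedBall (0 : P.Control) b)).exists_bound_of_continuousOn h.continuousOn
  refine ⟨c + P.lamTotal, fun ξ μ hξ hμ => ?_⟩
  have h1 := hc (ξ, μ) ⟨by simpa using hξ, by simpa using hμ⟩
  rw [runningCost]
  refine (abs_sub _ _).trans (add_le_add h1 ?_)
  rw [abs_of_nonneg (P.sparsity_nonneg μ)]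
  exact P.sparsity_le μ

/-- The real-valued objective; it agrees with `cost` along processes of finite cost. -/
def realCost (x : ℝ → P.State) (u : ℝ → P.Control) : ℝ :=
  (∫ t in Icc 0 P.T, P.runningCost (x t) (u t)) + 1 / 2 * (x P.T ⬝ᵥ (P.jointQhat *ᵥ x P.T))

variable {P} {x xs : ℝ → P.State} {u us v : ℝ → P.Control}

theorem cost_eq_realCost (h : IntegrableOn (fun t => P.runningCost (x t) (u t)) (Icc 0 P.T)) :
    P.cost x u = (P.realCost x u : EReal) :=
  if_pos h

theorem IsAdmissible.continuousOn (h : P.IsAdmissible x u) : ContinuousOn x (Icc 0 P.T) := by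
  have := h.absCont.continuousOn
  rwa [uIcc_of_le P.T_pos.le] at this

/-- The control itself is not assumed integrable, but B u equals ẋ - A x a.e., and ẋ is integrable
by absolute continuity. -/
theorem IsAdmissible.integrableOn_jointB_mulVec (h : P.IsAdmissible x u) :
    IntegrableOn (fun t => P.jointB *ᵥ u t) (Icc 0 P.T) := by
  have h1 := h.absCont.integrableOn_of_ae_hasDerivAt P.T_pos.le h.ode
  have h2 : IntegrableOn (fun t => P.jointA *ᵥ x t) (Icc 0 P.T) :=
    ((continuous_const.matrix_mulVec continuous_id).comp_continuousOn
      h.continuousOn).integrableOn_Icc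
  exact (h1.sub h2).congr (.of_forall fun t => by simp)

theorem IsAdmissible.integrableOn_runningCost (h : P.IsAdmissible x u) {M : ℝ}
    (hM : ∀ t ∈ Icc 0 P.T, ‖u t‖ ≤ M) :
    IntegrableOn (fun t => P.runningCost (x t) (u t)) (Icc 0 P.T) := by
  obtain ⟨a, ha⟩ := isCompact_Icc.exists_bound_of_continuousOn h.continuousOn
  obtain ⟨c, hc⟩ := P.exists_runningCost_bound a M
  refine Integrable.of_bound (C := c) ?_ ?_
  · exact (P.measurable_runningCost.comp_aemeasurable
      ((h.continuousOn.aemeasurable measurableSet_Icc).prodMk h.measurable)).aestronglyMeasurable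
  · filter_upwards [ae_restrict_mem measurableSet_Icc] with t ht
    exact hc _ _ (ha t ht) (hM t ht)

variable (P) in
/-- Replacing the control changes the state by at most a multiple of the `L¹` norm of the change
of the forcing term. -/
theorem exists_process_of_control : ∃ C, 0 ≤ C ∧ ∀ (xs : ℝ → P.State) (us v : ℝ → P.Control),
    P.IsAdmissible xs us → AEMeasurable v (volume.restrict (Icc 0 P.T)) →
    (∀ t ∈ Icc 0 P.T, v t ∈ P.admissibleActions) →
    IntegrableOn (fun t => P.jointB *ᵥ (v t - us t)) (Icc 0 P.T) →
    ∃ x, P.IsAdmissible x v ∧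
      ∀ t ∈ Icc 0 P.T, ‖x t - xs t‖ ≤ C * ∫ s in Icc 0 P.T, ‖P.jointB *ᵥ (v s - us s)‖ := by
  obtain ⟨C, hC0, hC⟩ := exists_linearODE_bound
    (Matrix.mulVecLin P.jointA).toContinuousLinearMap P.T_pos.le
  refine ⟨C, hC0, fun xs us v hs hvm hv hi => ?_⟩
  -- By linearity the difference of the states solves the same system with forcing B(v - us) and
  -- zero initial value.
  obtain ⟨y, hyac, hy0, hyd, hyb⟩ := hC _ hi
  refine ⟨fun t => xs t + y t, ⟨hvm, hv, hs.absCont.fun_add hyac, ?_, ?_⟩, fun t ht => ?_⟩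
  · filter_upwards [hs.ode, hyd] with t h1 h2
    convert! h1.add h2 using 1
    simp only [LinearMap.coe_toContinuousLinearMap', Matrix.mulVecLin_apply, Matrix.mulVec_add,
      Matrix.mulVec_sub]
    abel
  · simp [hy0, hs.init]
  · simpa using hyb t ht

/-- Local minimizers have finite cost. -/
theorem IsLocalMinimizer.integrableOn_runningCost (h : P.IsLocalMinimizer xs us) :
    IntegrableOn (fun t => P.runningCost (xs t) (us t)) (Icc 0 P.T) := by
  by_contra hni
  obtain ⟨hadm, ε, hε, hmin⟩ := h
  obtain ⟨C, hC0, hC⟩ := P.exists_process_of_control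
  -- Truncation sends large actions to zero. It keeps admissibility and makes the cost finite, while
  -- B(φ n u - u) tends to zero in L¹, so for large n the truncated process is close enough to
  -- contradict infinite minimal cost.
  let φ : ℕ → P.Control → P.Control := fun n => (Metric.closedBall 0 (n : ℝ)).indicator id
  have hφm : ∀ n, Measurable (φ n) := fun n =>
    measurable_id.indicator Metric.isClosed_closedBall.measurableSet
  have hφ : ∀ n w, φ n w = w ∨ φ n w = 0 := fun n w => by
    by_cases hw : w ∈ Metric.closedBall (0 : P.Control) (n : ℝ)
    · exact Or.inl (indicator_of_mem hw _)
    · exact Or.inr (indicator_of_notMem hw _)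
  have hφn : ∀ n w, ‖φ n w‖ ≤ n := fun n w => by
    by_cases hw : w ∈ Metric.closedBall (0 : P.Control) (n : ℝ)
    · simp only [φ, indicator_of_mem hw, id]; simpa using hw
    · simp [φ, indicator_of_notMem hw]
  have hcB : Continuous fun w : P.Control => P.jointB *ᵥ w :=
    continuous_const.matrix_mulVec continuous_id
  have hmeas : ∀ n, AEStronglyMeasurable (fun t => P.jointB *ᵥ (φ n (us t) - us t))
      (volume.restrict (Icc 0 P.T)) := fun n =>
    (hcB.measurable.comp_aemeasurable
      (((hφm n).comp_aemeasurable hadm.measurable).sub hadm.measurable)).aestronglyMeasurable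
  have hbound : ∀ n t, ‖P.jointB *ᵥ (φ n (us t) - us t)‖ ≤ ‖P.jointB *ᵥ us t‖ := fun n t => by
    rcases hφ n (us t) with h | h
    · rw [h]; simp
    · rw [h, zero_sub, Matrix.mulVec_neg, norm_neg]
  have hint := hadm.integrableOn_jointB_mulVec
  have hlim : Filter.Tendsto
      (fun n : ℕ => ∫ t in Icc 0 P.T, ‖P.jointB *ᵥ (φ n (us t) - us t)‖) Filter.atTop (nhds 0) := by
    have := tendsto_integral_of_dominated_convergence (μ := volume.restrict (Icc 0 P.T))
      (F := fun (n : ℕ) t => ‖P.jointB *ᵥ (φ n (us t) - us t)‖) (f := fun _ => 0)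
      (fun t => ‖P.jointB *ᵥ us t‖) (fun n => (hmeas n).norm) hint.norm
      (fun n => .of_forall fun t => by simpa using hbound n t)
      (.of_forall fun t => ?_)
    · simpa using this
    · obtain ⟨n₀, hn₀⟩ := exists_nat_ge ‖us t‖
      refine tendsto_const_nhds.congr' ?_
      filter_upwards [Filter.eventually_ge_atTop n₀] with n hn
      have : us t ∈ Metric.closedBall (0 : P.Control) (n : ℝ) := by
        simpa using hn₀.trans (Nat.cast_le.2 hn)
      simp [φ, indicator_of_mem this]
  have hlim' := hlim.const_mul C
  rw [mul_zero] at hlim'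
  obtain ⟨n, hn⟩ := (hlim'.eventually_lt_const hε).exists
  obtain ⟨x, hx, hxb⟩ := hC xs us (fun t => φ n (us t)) hadm
    ((hφm n).comp_aemeasurable hadm.measurable)
    (fun t ht => by
      rcases hφ n (us t) with h | h
      · rw [h]; exact hadm.mem t ht
      · rw [h]; exact P.zero_mem_admissibleActions)
    (Integrable.mono hint (hmeas n) (.of_forall (hbound n)))
  have hle := hmin x _ hx fun t ht => (hxb t ht).trans hn.le
  rw [cost_eq_realCost (hx.integrableOn_runningCost fun t _ => hφn n (us t)),
    cost, if_neg hni] at hle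
  exact absurd hle (not_le.2 (EReal.coe_lt_top _))

/-! ### The adjoint state and the exact cost increment. -/

variable (P) in
/-- `p` solves the adjoint equation along `xs` with the transversality condition. -/
structure IsAdjoint (xs p : ℝ → P.State) : Prop where
  absCont : AbsolutelyContinuousOnInterval p 0 P.T
  terminal : p P.T = -(P.jointQhat *ᵥ xs P.T)
  ode : ∀ᵐ t ∂(volume.restrict (Icc 0 P.T)),
    HasDerivAt p (-(P.jointAᵀ *ᵥ p t) + P.jointQ *ᵥ xs t) t

theorem IsAdmissible.exists_isAdjoint (h : P.IsAdmissible xs us) :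
    ∃ p, P.IsAdjoint xs p := by
  have hi : IntegrableOn (fun t => P.jointQ *ᵥ xs t) (Icc 0 P.T) :=
    ((continuous_const.matrix_mulVec continuous_id).comp_continuousOn
      h.continuousOn).integrableOn_Icc
  obtain ⟨p, h1, h2, h3⟩ := exists_linearODE_terminal
    (-(Matrix.mulVecLin P.jointAᵀ).toContinuousLinearMap) P.T_pos.le hi
    (-(P.jointQhat *ᵥ xs P.T))
  exact ⟨p, h1, h2, h3⟩

theorem IsAdjoint.continuousOn {p : ℝ → P.State} (h : P.IsAdjoint xs p) :
    ContinuousOn p (Icc 0 P.T) := by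
  have := h.absCont.continuousOn
  rwa [uIcc_of_le P.T_pos.le] at this

theorem hasDerivAt_dotProduct {ι : Type*} [Fintype ι] {f g : ℝ → ι → ℝ} {f' g' : ι → ℝ} {t : ℝ}
    (hf : HasDerivAt f f' t) (hg : HasDerivAt g g' t) :
    HasDerivAt (fun s => f s ⬝ᵥ g s) (f' ⬝ᵥ g t + f t ⬝ᵥ g') t := by
  have := HasDerivAt.fun_sum (u := Finset.univ) fun i _ =>
    ((hasDerivAt_pi.1 hf) i).mul ((hasDerivAt_pi.1 hg) i)
  simpa [dotProduct, Finset.sum_add_distrib] using this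

theorem hasDerivAt_mulVec {ι κ : Type*} [Fintype ι] [Fintype κ] (M : Matrix κ ι ℝ) {f : ℝ → ι → ℝ}
    {f' : ι → ℝ} {t : ℝ} (hf : HasDerivAt f f' t) :
    HasDerivAt (fun s => M *ᵥ f s) (M *ᵥ f') t :=
  (Matrix.mulVecLin M).toContinuousLinearMap.hasFDerivAt.comp_hasDerivAt t hf

/-- The exact increment of the cost in terms of the adjoint state. -/
theorem realCost_eq {p : ℝ → P.State} (hs : P.IsAdmissible xs us)
    (hsi : IntegrableOn (fun t => P.runningCost (xs t) (us t)) (Icc 0 P.T))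
    (hp : P.IsAdjoint xs p) (h : P.IsAdmissible x u)
    (hκ : IntegrableOn
      (fun t => P.controlHamiltonian (p t) (us t) - P.controlHamiltonian (p t) (u t))
      (Icc 0 P.T)) :
    IntegrableOn (fun t => P.runningCost (x t) (u t)) (Icc 0 P.T) ∧
    P.realCost x u = P.realCost xs us
      + (∫ t in Icc 0 P.T,
          (P.controlHamiltonian (p t) (us t) - P.controlHamiltonian (p t) (u t)))
      + (∫ t in Icc 0 P.T, 1 / 2 * ((x t - xs t) ⬝ᵥ (P.jointQ *ᵥ (x t - xs t))))
      + 1 / 2 * ((x P.T - xs P.T) ⬝ᵥ (P.jointQhat *ᵥ (x P.T - xs P.T))) := by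
  have hyac := h.absCont.fun_sub hs.absCont
  have hpy := hp.absCont.dotProduct hyac
  -- The terms with A cancel by the adjoint equation. The remaining derivative is exactly the
  -- first-order part of the increment, and its integral is the boundary term at T that
  -- transversality matches with the terminal cost.
  have hder : ∀ᵐ t ∂(volume.restrict (Icc 0 P.T)), HasDerivAt (fun t => p t ⬝ᵥ (x t - xs t))
      ((x t - xs t) ⬝ᵥ (P.jointQ *ᵥ xs t) + p t ⬝ᵥ (P.jointB *ᵥ u t)
        - p t ⬝ᵥ (P.jointB *ᵥ us t)) t := by
    filter_upwards [hs.ode, h.ode, hp.ode] with t h1 h2 h3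
    convert! hasDerivAt_dotProduct h3 (h2.fun_sub h1) using 1
    have hA : (P.jointAᵀ *ᵥ p t) ⬝ᵥ (x t - xs t)
        = p t ⬝ᵥ (P.jointA *ᵥ x t) - p t ⬝ᵥ (P.jointA *ᵥ xs t) := by
      rw [Matrix.mulVec_transpose, ← Matrix.dotProduct_mulVec, Matrix.mulVec_sub, dotProduct_sub]
    rw [add_dotProduct, neg_dotProduct, hA]
    simp only [dotProduct_sub, dotProduct_add,
      dotProduct_comm (P.jointQ *ᵥ xs t), sub_dotProduct]
    ring
  obtain ⟨hDi, hDe⟩ := hpy.integral_eq_sub_of_ae_hasDerivAt P.T_pos.le hder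
  have hq : IntegrableOn (fun t => 1 / 2 * ((x t - xs t) ⬝ᵥ (P.jointQ *ᵥ (x t - xs t))))
      (Icc 0 P.T) := by
    refine ContinuousOn.integrableOn_Icc ?_
    have hc : Continuous fun y : P.State => 1 / 2 * (y ⬝ᵥ (P.jointQ *ᵥ y)) :=
      continuous_const.mul
        (continuous_id.dotProduct (continuous_const.matrix_mulVec continuous_id))
    exact hc.comp_continuousOn (h.continuousOn.sub hs.continuousOn)
  have hpt : ∀ t, P.runningCost (x t) (u t) = P.runningCost (xs t) (us t)
      + (P.controlHamiltonian (p t) (us t) - P.controlHamiltonian (p t) (u t))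
      + 1 / 2 * ((x t - xs t) ⬝ᵥ (P.jointQ *ᵥ (x t - xs t)))
      + ((x t - xs t) ⬝ᵥ (P.jointQ *ᵥ xs t) + p t ⬝ᵥ (P.jointB *ᵥ u t)
        - p t ⬝ᵥ (P.jointB *ᵥ us t)) := fun t => by
    have := dotProduct_mulVec_add_of_isSymm P.jointQ_isSymm (xs t) (x t - xs t)
    rw [add_sub_cancel] at this
    rw [runningCost, this, runningCost, controlHamiltonian, controlHamiltonian]
    ring
  simp only [realCost, hpt]
  refine ⟨((hsi.add hκ).add hq).add hDi, ?_⟩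
  have e1 : ∫ t in Icc 0 P.T, (P.runningCost (xs t) (us t)
      + (P.controlHamiltonian (p t) (us t) - P.controlHamiltonian (p t) (u t))
      + 1 / 2 * ((x t - xs t) ⬝ᵥ (P.jointQ *ᵥ (x t - xs t)))
      + ((x t - xs t) ⬝ᵥ (P.jointQ *ᵥ xs t) + p t ⬝ᵥ (P.jointB *ᵥ u t)
        - p t ⬝ᵥ (P.jointB *ᵥ us t))) = _ := integral_add ((hsi.add hκ).add hq) hDi
  have e2 : ∫ t in Icc 0 P.T, (P.runningCost (xs t) (us t)
      + (P.controlHamiltonian (p t) (us t) - P.controlHamiltonian (p t) (u t))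
      + 1 / 2 * ((x t - xs t) ⬝ᵥ (P.jointQ *ᵥ (x t - xs t)))) = _ :=
    integral_add (hsi.add hκ) hq
  have e3 : ∫ t in Icc 0 P.T, (P.runningCost (xs t) (us t)
      + (P.controlHamiltonian (p t) (us t) - P.controlHamiltonian (p t) (u t))) = _ :=
    integral_add hsi hκ
  have e4 := dotProduct_mulVec_add_of_isSymm P.jointQhat_isSymm (xs P.T) (x P.T - xs P.T)
  rw [add_sub_cancel] at e4
  rw [e1, e2, e3, hDe, e4, h.init, hs.init, sub_self, dotProduct_zero, hp.terminal,
    neg_dotProduct, dotProduct_comm (P.jointQhat *ᵥ xs P.T)]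
  ring

end MuxLQ

/-! ### Needle variations and the maximum principle. -/

namespace MuxLQ

variable {N : ℕ} {P : MuxLQ N} {xs p : ℝ → P.State} {us v : ℝ → P.Control}

/-- Modifying a control on a set `E` on which this gains at least `δ` in the Hamiltonian changes
the state by `O(|E|)` and increases the cost by at most `-δ |E| + O(|E|²)`. -/
theorem IsAdmissible.exists_needle_variation (hadm : P.IsAdmissible xs us)
    (hsi : IntegrableOn (fun t => P.runningCost (xs t) (us t)) (Icc 0 P.T))
    (hp : P.IsAdjoint xs p) (hvm : AEMeasurable v (volume.restrict (Icc 0 P.T)))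
    (hv : ∀ t ∈ Icc 0 P.T, v t ∈ P.admissibleActions) {M : ℝ} (hM : ∀ t ∈ Icc 0 P.T, ‖v t‖ ≤ M)
    {n : ℝ} (hn : 0 ≤ n) :
    ∃ D q : ℝ, 0 ≤ D ∧ 0 ≤ q ∧ ∀ (δ : ℝ) (E : Set ℝ), MeasurableSet E → E ⊆ Icc 0 P.T →
      (∀ t ∈ E, P.controlHamiltonian (p t) (us t) + δ ≤ P.controlHamiltonian (p t) (v t) ∧
        ‖us t‖ ≤ n) →
      ∃ x u, P.IsAdmissible x u ∧ (∀ t ∈ Icc 0 P.T, ‖x t - xs t‖ ≤ D * volume.real E) ∧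
        IntegrableOn (fun t => P.runningCost (x t) (u t)) (Icc 0 P.T) ∧
        P.realCost x u ≤ P.realCost xs us - δ * volume.real E + q * volume.real E ^ 2 := by
  classical
  have hpm : AEMeasurable p (volume.restrict (Icc 0 P.T)) :=
    hp.continuousOn.aemeasurable measurableSet_Icc
  obtain ⟨C, hC0, hC⟩ := P.exists_process_of_control
  obtain ⟨b, hb0, hb⟩ := exists_mulVec_bound P.jointB
  obtain ⟨q₁, hq₁0, hq₁⟩ := exists_quadratic_bound P.jointQ
  obtain ⟨q₂, hq₂0, hq₂⟩ := exists_quadratic_bound P.jointQhat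
  obtain ⟨a, ha⟩ := isCompact_Icc.exists_bound_of_continuousOn hp.continuousOn
  obtain ⟨c₁, hc₁⟩ := P.exists_controlHamiltonian_bound a n
  obtain ⟨c₂, hc₂⟩ := P.exists_controlHamiltonian_bound a M
  have hM0 : 0 ≤ M := (norm_nonneg _).trans (hM 0 ⟨le_rfl, P.T_pos.le⟩)
  have hT := P.T_pos
  -- On E the forcing changes by at most b(M + n), which yields D after integration; q collects the
  -- running and terminal quadratic terms, each bounded through (D|E|)².
  refine ⟨C * (b * (M + n)), 1 / 2 * (P.T * q₁ + q₂) * (C * (b * (M + n))) ^ 2,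
    by positivity, by positivity, fun δ E hEm hEIcc hE1 => ?_⟩
  generalize hD : C * (b * (M + n)) = D
  have hEr : (volume.restrict (Icc 0 P.T)).real E = volume.real E := by
    rw [measureReal_restrict_apply hEm, inter_eq_left.2 hEIcc]
  generalize volume.real E = e at hEr ⊢
  obtain ⟨u, hu⟩ : ∃ u : ℝ → P.Control, u = E.piecewise v us := ⟨_, rfl⟩
  have huE : ∀ t ∈ E, u t = v t := fun t ht => by rw [hu, piecewise_eq_of_mem _ _ _ ht]
  have huE' : ∀ t ∉ E, u t = us t := fun t ht => by rw [hu, piecewise_eq_of_notMem _ _ _ ht]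
  have hum : AEMeasurable u (volume.restrict (Icc 0 P.T)) := by
    -- Written as a sum with an indicator, the spliced control inherits a.e. measurability.
    have h1 : u = fun t => us t + E.indicator (fun t => v t - us t) t := by
      ext1 t
      by_cases ht : t ∈ E
      · simp [huE t ht, ht]
      · simp [huE' t ht, ht]
    rw [h1]
    exact hadm.measurable.add ((hvm.sub hadm.measurable).indicator hEm)
  have hind : Integrable (E.indicator fun _ => (1 : ℝ)) (volume.restrict (Icc 0 P.T)) :=
    (integrable_const 1).indicator hEm
  have hintE : ∀ c : ℝ, ∫ t in Icc 0 P.T, c * E.indicator (fun _ => (1 : ℝ)) t = c * e := by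
    intro c
    rw [integral_const_mul, integral_indicator_const _ hEm, hEr]
    simp
  have hBle : ∀ t, ‖P.jointB *ᵥ (u t - us t)‖
      ≤ b * (M + n) * E.indicator (fun _ => (1 : ℝ)) t := fun t => by
    by_cases ht : t ∈ E
    · rw [huE t ht, indicator_of_mem ht, mul_one]
      refine (hb _).trans (mul_le_mul_of_nonneg_left ?_ hb0)
      exact (norm_sub_le _ _).trans (add_le_add (hM t (hEIcc ht)) (hE1 t ht).2)
    · simp [huE' t ht, ht]
  have hcB : Continuous fun w : P.Control => P.jointB *ᵥ w :=
    continuous_const.matrix_mulVec continuous_id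
  have hBi : IntegrableOn (fun t => P.jointB *ᵥ (u t - us t)) (Icc 0 P.T) :=
    Integrable.mono' (hind.const_mul (b * (M + n)))
      (hcB.measurable.comp_aemeasurable (hum.sub hadm.measurable)).aestronglyMeasurable
      (.of_forall hBle)
  obtain ⟨x, hx, hxb⟩ := hC xs us u hadm hum (fun t ht => by
    by_cases htE : t ∈ E
    · rw [huE t htE]; exact hv t ht
    · rw [huE' t htE]; exact hadm.mem t ht) hBi
  have hxe : ∀ t ∈ Icc 0 P.T, ‖x t - xs t‖ ≤ D * e := fun t ht => by
    refine (hxb t ht).trans ?_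
    rw [← hD, mul_assoc C]
    refine mul_le_mul_of_nonneg_left ?_ hC0
    rw [← hintE]
    exact integral_mono hBi.norm (hind.const_mul _) hBle
  have hκle : ∀ t, P.controlHamiltonian (p t) (us t) - P.controlHamiltonian (p t) (u t)
      ≤ (-δ) * E.indicator (fun _ => (1 : ℝ)) t := fun t => by
    by_cases ht : t ∈ E
    · have := (hE1 t ht).1
      rw [huE t ht, indicator_of_mem ht, mul_one]
      linarith
    · simp [huE' t ht, ht]
  have hκi : IntegrableOn
      (fun t => P.controlHamiltonian (p t) (us t) - P.controlHamiltonian (p t) (u t))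
      (Icc 0 P.T) := by
    refine Integrable.of_bound (C := max (c₁ + c₂) 0) (AEMeasurable.sub
      (P.aemeasurable_controlHamiltonian hpm hadm.measurable)
      (P.aemeasurable_controlHamiltonian hpm hum)).aestronglyMeasurable ?_
    filter_upwards [ae_restrict_mem measurableSet_Icc] with t ht
    by_cases htE : t ∈ E
    · refine le_max_of_le_left ?_
      rw [huE t htE]
      exact (abs_sub _ _).trans
        (add_le_add (hc₁ _ _ (ha t ht) (hE1 t htE).2) (hc₂ _ _ (ha t ht) (hM t ht)))
    · simp [huE' t htE]
  obtain ⟨hxi, hxeq⟩ := realCost_eq hadm hsi hp hx hκi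
  refine ⟨x, u, hx, hxe, hxi, ?_⟩
  have h1 : ∫ t in Icc 0 P.T,
      (P.controlHamiltonian (p t) (us t) - P.controlHamiltonian (p t) (u t)) ≤ -δ * e := by
    rw [← hintE]
    exact integral_mono hκi (hind.const_mul _) hκle
  have hsq : ∀ t ∈ Icc 0 P.T, ‖x t - xs t‖ ^ 2 ≤ (D * e) ^ 2 := fun t ht =>
    pow_le_pow_left₀ (norm_nonneg _) (hxe t ht) 2
  have h2 : ∫ t in Icc 0 P.T, 1 / 2 * ((x t - xs t) ⬝ᵥ (P.jointQ *ᵥ (x t - xs t)))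
      ≤ P.T * (1 / 2 * (q₁ * (D * e) ^ 2)) := by
    have hb : ∀ t ∈ Icc 0 P.T, 1 / 2 * ((x t - xs t) ⬝ᵥ (P.jointQ *ᵥ (x t - xs t)))
        ≤ 1 / 2 * (q₁ * (D * e) ^ 2) := fun t ht => by
      have := (hq₁ (x t - xs t)).trans (mul_le_mul_of_nonneg_left (hsq t ht) hq₁0)
      linarith
    have hcq : Continuous fun y : P.State => 1 / 2 * (y ⬝ᵥ (P.jointQ *ᵥ y)) :=
      continuous_const.mul
        (continuous_id.dotProduct (continuous_const.matrix_mulVec continuous_id))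
    have hi : IntegrableOn (fun t => 1 / 2 * ((x t - xs t) ⬝ᵥ (P.jointQ *ᵥ (x t - xs t))))
        (Icc 0 P.T) :=
      (hcq.comp_continuousOn (hx.continuousOn.sub hadm.continuousOn)).integrableOn_Icc
    refine (setIntegral_mono_on hi (integrableOn_const measure_Icc_lt_top.ne)
      measurableSet_Icc hb).trans (le_of_eq ?_)
    simp [hT.le]
  have h3 : (x P.T - xs P.T) ⬝ᵥ (P.jointQhat *ᵥ (x P.T - xs P.T)) ≤ q₂ * (D * e) ^ 2 :=
    (hq₂ _).trans (mul_le_mul_of_nonneg_left (hsq P.T ⟨hT.le, le_rfl⟩) hq₂0)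
  rw [hxeq]
  linarith

/-- The gain in the Hamiltonian is a.e. nonpositive for bounded admissible variations of the
control of a local minimizer. -/
theorem IsLocalMinimizer.controlHamiltonian_le (h : P.IsLocalMinimizer xs us)
    (hp : P.IsAdjoint xs p) (hvm : AEMeasurable v (volume.restrict (Icc 0 P.T)))
    (hv : ∀ t ∈ Icc 0 P.T, v t ∈ P.admissibleActions) {M : ℝ} (hM : ∀ t ∈ Icc 0 P.T, ‖v t‖ ≤ M) :
    ∀ᵐ t ∂(volume.restrict (Icc 0 P.T)),
      P.controlHamiltonian (p t) (v t) ≤ P.controlHamiltonian (p t) (us t) := by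
  have hsi := h.integrableOn_runningCost
  obtain ⟨hadm, ε, hε, hmin⟩ := h
  have hpm : AEMeasurable p (volume.restrict (Icc 0 P.T)) :=
    hp.continuousOn.aemeasurable measurableSet_Icc
  have hK1 : AEMeasurable (fun t => P.controlHamiltonian (p t) (us t))
      (volume.restrict (Icc 0 P.T)) :=
    P.aemeasurable_controlHamiltonian hpm hadm.measurable
  have hK2 : AEMeasurable (fun t => P.controlHamiltonian (p t) (v t))
      (volume.restrict (Icc 0 P.T)) :=
    P.aemeasurable_controlHamiltonian hpm hvm
  -- Countably many sets exhaust the times of strict gain. The bound on us, which may be unbounded,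
  -- makes the estimates uniform on each of them.
  suffices hn : ∀ n : ℕ, ∀ᵐ t ∂(volume.restrict (Icc 0 P.T)),
      ¬ (P.controlHamiltonian (p t) (us t) + 1 / ((n : ℝ) + 1)
          ≤ P.controlHamiltonian (p t) (v t) ∧ ‖us t‖ ≤ n) by
    filter_upwards [ae_all_iff.2 hn] with t ht
    by_contra hlt
    rw [not_le] at hlt
    obtain ⟨n₁, hn₁⟩ := exists_nat_one_div_lt (sub_pos.2 hlt)
    obtain ⟨n₂, hn₂⟩ := exists_nat_ge ‖us t‖
    refine ht (max n₁ n₂) ⟨?_, hn₂.trans (by simp)⟩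
    have : 1 / (((max n₁ n₂ : ℕ) : ℝ) + 1) ≤ 1 / ((n₁ : ℝ) + 1) := by
      gcongr; exact le_max_left _ _
    linarith
  intro n
  have hδ : (0 : ℝ) < 1 / ((n : ℝ) + 1) := by positivity
  generalize 1 / ((n : ℝ) + 1) = δ at hδ ⊢
  have hF : NullMeasurableSet ({t | P.controlHamiltonian (p t) (us t) + δ
      ≤ P.controlHamiltonian (p t) (v t)} ∩ {t | ‖us t‖ ≤ n}) (volume.restrict (Icc 0 P.T)) :=
    (nullMeasurableSet_le (hK1.add_const δ) hK2).inter
      (nullMeasurableSet_le hadm.measurable.norm aemeasurable_const)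
  obtain ⟨D, q, hD0, hq0, hneedle⟩ :=
    hadm.exists_needle_variation hsi hp hvm hv hM (Nat.cast_nonneg n)
  refine ae_restrict_notMem_of_forall_small hF
    -- The first bound keeps the varied state within ε, the second makes q|E|² smaller than δ|E|;
    -- adding 1 avoids dividing by zero.
    (show 0 < min (ε / (D + 1)) (δ / (q + 1)) by positivity) fun E hEsub hEm hEpos hEle => ?_
  obtain ⟨x, u, hx, hxe, hxi, hcost⟩ := hneedle δ E hEm (fun t ht => (hEsub ht).2)
    fun t ht => ⟨(hEsub ht).1.1, (hEsub ht).1.2⟩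
  generalize volume.real E = e at hEpos hEle hxe hcost
  have heε : D * e ≤ ε := by
    have h1 : e ≤ ε / (D + 1) := hEle.trans (min_le_left _ _)
    rw [le_div_iff₀ (by positivity)] at h1
    linarith
  have heδ : q * e < δ := by
    have h1 : e ≤ δ / (q + 1) := hEle.trans (min_le_right _ _)
    rw [le_div_iff₀ (by positivity)] at h1
    linarith
  have hle := hmin x u hx fun t ht => (hxe t ht).trans heε
  rw [cost_eq_realCost hsi, cost_eq_realCost hxi, EReal.coe_le_coe_iff] at hle
  have h5 := mul_lt_mul_of_pos_right heδ hEpos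
  linarith

/-! ### Constancy of the Hamiltonian. -/

theorem lipschitzWith_finset_sup' {ι : Type*} [Fintype ι] (hne : (Finset.univ : Finset ι).Nonempty) :
    LipschitzWith 1 fun w : ι → ℝ => Finset.univ.sup' hne w := by
  refine LipschitzWith.of_le_add fun v w => Finset.sup'_le _ _ fun i _ => ?_
  have h1 : v i ≤ w i + dist v w := by
    have := (le_abs_self _).trans (dist_le_pi_dist v w i)
    linarith
  exact h1.trans (add_le_add_left (Finset.le_sup' w (Finset.mem_univ i)) _)

variable (P) in
/-- The Hamiltonian maximized over the admissible actions. -/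
def maxHamiltonian (p ξ : P.State) : ℝ :=
  p ⬝ᵥ (P.jointA *ᵥ ξ) - 1 / 2 * (ξ ⬝ᵥ (P.jointQ *ᵥ ξ)) +
    Finset.univ.sup' ⟨⟨0, P.N_pos⟩, Finset.mem_univ _⟩ (P.muxValue p)

/-- The maximization removes the control, so no regularity of it enters; a finite maximum is
Lipschitz and preserves absolute continuity. -/
theorem absolutelyContinuousOnInterval_maxHamiltonian {x p : ℝ → P.State} {a b : ℝ}
    (hx : AbsolutelyContinuousOnInterval x a b) (hp : AbsolutelyContinuousOnInterval p a b) :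
    AbsolutelyContinuousOnInterval (fun t => P.maxHamiltonian (p t) (x t)) a b := by
  have hq := (hx.dotProduct (hx.mulVec P.jointQ)).const_mul (1 / 2)
  refine ((hp.dotProduct (hx.mulVec P.jointA)).fun_sub hq).fun_add
    ((lipschitzWith_finset_sup' _).comp_absolutelyContinuousOnInterval (.pi fun k => ?_))
  have hblock : AbsolutelyContinuousOnInterval (fun t => block (p t) k) a b :=
    .pi fun i => hp.apply _
  have hc : AbsolutelyContinuousOnInterval (fun t => P.candidate k (p t)) a b :=
    (hblock.mulVec _).mulVec _
  have hn : AbsolutelyContinuousOnInterval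
      (fun t => P.lamCompl k + 1 / 2 * P.adjNormSq k (p t)) a b := by
    simp only [adjNormSq_eq]
    exact (AbsolutelyContinuousOnInterval.const _).fun_add
      ((hc.dotProduct (hc.mulVec _)).const_mul _)
  simp only [muxValue_eq_max]
  exact (LipschitzWith.id.const_max P.lamTotal).comp_absolutelyContinuousOnInterval hn

theorem hamiltonian_le_maxHamiltonian (p ξ : P.State) {μ : P.Control}
    (hμ : μ ∈ P.admissibleActions) : P.hamiltonian p ξ μ ≤ P.maxHamiltonian p ξ := by
  obtain ⟨k, hk⟩ := mem_iUnion.1 hμ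
  rw [hamiltonian_eq, maxHamiltonian]
  exact add_le_add_right
    ((P.controlHamiltonian_le hk p).trans (Finset.le_sup' (P.muxValue p) (Finset.mem_univ _))) _

/-- An envelope argument: the maximized Hamiltonian and the one with frozen control touch at t, so
their derivatives there agree. -/
theorem IsAdmissible.exists_hamiltonian_eq_const (h : P.IsAdmissible xs us)
    (hp : P.IsAdjoint xs p) (hmax : ∀ᵐ t ∂(volume.restrict (Icc 0 P.T)),
      P.hamiltonian (p t) (xs t) (us t) = P.maxHamiltonian (p t) (xs t)) :
    ∃ c : ℝ, ∀ᵐ t ∂(volume.restrict (Icc 0 P.T)),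
      P.hamiltonian (p t) (xs t) (us t) = c := by
  have hac := absolutelyContinuousOnInterval_maxHamiltonian h.absCont hp.absCont
  have hIoo : ∀ᵐ t ∂(volume.restrict (Icc 0 P.T)), t ∈ Ioo 0 P.T := by
    rw [← restrict_Ioo_eq_restrict_Icc]
    exact ae_restrict_mem measurableSet_Ioo
  have hzero : ∀ᵐ t ∂(volume.restrict (Icc 0 P.T)),
      HasDerivAt (fun t => P.maxHamiltonian (p t) (xs t)) 0 t := by
    filter_upwards [hmax, hIoo, h.ode, hp.ode, ae_restrict_of_ae hac.ae_differentiableAt]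
      with t h1 h2 h3 h4 h5
    have h2' := Ioo_subset_Icc_self h2
    have hd := (h5 (by rwa [uIcc_of_le P.T_pos.le])).hasDerivAt
    have hham : HasDerivAt (fun s => P.hamiltonian (p s) (xs s) (us t)) 0 t := by
      have e1 := hasDerivAt_dotProduct h4
        ((hasDerivAt_mulVec P.jointA h3).add_const (P.jointB *ᵥ us t))
      have e2 := (hasDerivAt_dotProduct h3 (hasDerivAt_mulVec P.jointQ h3)).add_const
        (us t ⬝ᵥ (P.jointR *ᵥ us t))
      have e3 := (e1.add_const (P.sparsity (us t))).fun_sub (e2.const_mul (1 / 2))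
      refine e3.congr_deriv ?_
      -- With w = ẋ, the contributions of ṗ and ẋ cancel by the canonical equations and the symmetry
      -- of Q.
      set w := P.jointA *ᵥ xs t + P.jointB *ᵥ us t
      have hA : (P.jointAᵀ *ᵥ p t) ⬝ᵥ w = p t ⬝ᵥ (P.jointA *ᵥ w) := by
        rw [Matrix.mulVec_transpose, ← Matrix.dotProduct_mulVec]
      rw [dotProduct_mulVec_comm_of_isSymm P.jointQ_isSymm (xs t) w, add_dotProduct,
        neg_dotProduct, hA, dotProduct_comm (P.jointQ *ᵥ xs t)]
      ring
    have hmin : IsLocalMin (fun s => P.maxHamiltonian (p s) (xs s)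
        - P.hamiltonian (p s) (xs s) (us t)) t := by
      refine .of_forall fun s => ?_
      beta_reduce
      rw [h1, sub_self]
      exact sub_nonneg.2 (hamiltonian_le_maxHamiltonian _ _ (h.mem t h2'))
    have := hmin.hasDerivAt_eq_zero (hd.fun_sub hham)
    rw [sub_zero] at this
    rwa [this] at hd
  obtain ⟨c, hc⟩ := hac.const_of_ae_hasDerivAt_zero (by
    rw [uIcc_of_le P.T_pos.le]
    exact (ae_restrict_iff' measurableSet_Icc).1 hzero)
  refine ⟨c, ?_⟩
  filter_upwards [hmax, ae_restrict_mem measurableSet_Icc] with t h1 h2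
  rw [h1, hc t (by rwa [uIcc_of_le P.T_pos.le])]

end MuxLQ

end

/-! ### Assembly of the necessary conditions. -/

theorem theorem2 {N : ℕ} (P : MuxLQ N) (xs : ℝ → P.State) (us : ℝ → P.Control)
    (hmin : P.IsLocalMinimizer xs us) :
    ∃ (p : ℝ → P.State) (σ : ℝ → Fin N),
      AbsolutelyContinuousOnInterval p 0 P.T ∧
      Measurable σ ∧
      xs 0 = P.jointInit ∧
      p P.T = -(P.jointQhat *ᵥ xs P.T) ∧
      (∀ᵐ t ∂(volume.restrict (Icc 0 P.T)),
        HasDerivAt xs (P.jointA *ᵥ xs t + P.jointB *ᵥ us t) t ∧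
        HasDerivAt p (-(P.jointAᵀ *ᵥ p t) + P.jointQ *ᵥ xs t) t ∧
        (∀ k : Fin N,
          MuxLQ.block (us t) k ∈ if k = σ t then P.activeSet k (p t) else {0}) ∧
        (∀ k : Fin N, P.muxValue (p t) k ≤ P.muxValue (p t) (σ t))) ∧
      (∃ h : ℝ, ∀ᵐ t ∂(volume.restrict (Icc 0 P.T)),
        P.hamiltonian (p t) (xs t) (us t) = h) := by
  obtain ⟨p, hp⟩ := hmin.1.exists_isAdjoint
  obtain ⟨s, hs, hs'⟩ := P.exists_measurable_activeIndex
  have hadm := hmin.1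
  have hzero := hmin.controlHamiltonian_le hp (v := fun _ => 0) (M := 0) aemeasurable_const
    (fun _ _ => P.zero_mem_admissibleActions) (by simp)
  have hcand : ∀ᵐ t ∂(volume.restrict (Icc 0 P.T)), ∀ k,
      P.controlHamiltonian (p t) (MuxLQ.embed k (P.candidate k (p t)))
        ≤ P.controlHamiltonian (p t) (us t) := by
    refine ae_all_iff.2 fun k => ?_
    have hcont : ContinuousOn (fun t => P.candidate k (p t)) (Icc 0 P.T) :=
      (P.continuous_candidate k).comp_continuousOn hp.continuousOn
    -- Continuity of p bounds the candidates on the compact interval, as a needle variation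
    -- requires.
    obtain ⟨M, hM⟩ := isCompact_Icc.exists_bound_of_continuousOn hcont
    exact hmin.controlHamiltonian_le hp
      (((MuxLQ.continuous_embed k).comp_continuousOn hcont).aemeasurable measurableSet_Icc)
      (fun t _ => P.embed_mem_admissibleActions k _)
      fun t ht => (MuxLQ.norm_embed k _).trans (hM t ht)
  -- A measurable representative of us makes σ measurable everywhere, not just almost everywhere.
  have hσ : ∀ᵐ t ∂(volume.restrict (Icc 0 P.T)), us t = hadm.measurable.mk us t :=
    hadm.measurable.ae_eq_mk
  have hall : ∀ᵐ t ∂(volume.restrict (Icc 0 P.T)),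
      (∀ l, l ≠ s (hadm.measurable.mk us t) → MuxLQ.block (us t) l = 0) ∧
      MuxLQ.block (us t) (s (hadm.measurable.mk us t))
        ∈ P.activeSet (s (hadm.measurable.mk us t)) (p t) ∧
      (∀ l, P.muxValue (p t) l ≤ P.muxValue (p t) (s (hadm.measurable.mk us t))) ∧
      P.controlHamiltonian (p t) (us t)
        = P.muxValue (p t) (s (hadm.measurable.mk us t)) := by
    filter_upwards [hzero, hcand, hσ, ae_restrict_mem measurableSet_Icc] with t h0 hc h1 ht
    rw [← h1]
    have hblock := hs' _ (hadm.mem t ht)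
    exact ⟨hblock, P.maximum_condition hblock h0 hc⟩
  refine ⟨p, fun t => s (hadm.measurable.mk us t), hp.absCont,
    hs.comp hadm.measurable.measurable_mk, hadm.init, hp.terminal, ?_, ?_⟩
  · filter_upwards [hadm.ode, hp.ode, hall] with t h1 h2 ⟨h3, h4, h5, _⟩
    refine ⟨h1, h2, fun k => ?_, h5⟩
    split_ifs with hk
    · rw [hk]; exact h4
    · exact h3 k hk
  · refine hadm.exists_hamiltonian_eq_const hp ?_
    filter_upwards [hall] with t ⟨_, _, h5, h6⟩
    rw [MuxLQ.hamiltonian_eq, MuxLQ.maxHamiltonian, h6]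
    congr 1
    exact le_antisymm (Finset.le_sup' (P.muxValue (p t)) (Finset.mem_univ _))
      (Finset.sup'_le _ _ fun l _ => h5 l)
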